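/- **Setting.** Let $n\ge 1$, $\alpha>0$, $\Gamma_+=\{\kappa\in\mathbb R^n:\kappa_i>0 \text{ for all } i\}$, and let $f:\Gamma_+\to(0,\infty)$ be smooth, symmetric, homogeneous of degree one, with $\partial f/\partial\kappa_i>0$ for every $i$; $f$ is extended continuously to $\overline{\Gamma_+}$. Consider the motion of hypersurfaces $M_t=\partial\Omega_t$ in $\mathbb R^{n+1}=\mathbb R^n\times\mathbb R$ with inward normal speed $S=f(\kappa)^\alpha$, where $\kappa=(\kappa_1,\dots,\kappa_n)$ are the principal curvatures. A *smooth subsolution* (resp. *supersolution*) on $[a,b]$, $a<b$, is a family $(\Omega(t))_{t\in[a,b]}$ of closed sets with smooth boundary depending smoothly on $t$, whose boundaries have principal curvatures $\kappa\in\Gamma_+$ and inward normal velocity at least (resp. at most) $f(\kappa)^\alpha$ at every point. A family $(\Omega_t)_{0\le t<T}$ of subsets of $\mathbb R^{n+1}$ is a *barrier solution* if for every $[a,b]\subset[0,T)$ and every $t\in[a,b]$: $\Omega(a)\subseteq\Omega_a$ implies $\Omega(t)\subseteq\Omega_t$ for each smooth subsolution $\Omega(\cdot)$ on $[a,b]$,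 and $\Omega_a\subseteq\Omega(a)$ implies $\Omega_t\subseteq\Omega(t)$ for each smooth supersolution $\Omega(\cdot)$ on $[a,b]$. Write $B_r$ for the open ball of radius $r$ about $0$ in $\mathbb R^n$ and $\overline B_r$ for the closed one ($\overline B_0=\{0\}$, $B_0=\emptyset$). Put $\hat f(x)=f(x,1,\dots,1)$ and $g(x)=\hat f(x)^\alpha-\hat f(0)^\alpha$ for $x\ge0$; $g$ is strictly increasing, and $g^{-1}(z)=\infty$ (so $1/g^{-1}(z)=0$) for $z$ above its range. Let $r(t)=\bigl(1-(1+\alpha)\hat f(0)^\alpha t\bigr)^{1/(1+\alpha)}$, and suppose $$\int_0^1\frac{dz}{g^{-1}(z)}<\infty .$$ **(1)** There is $\tau>0$, depending only on $n,f,\alpha$, with $(1+\alpha)\hat f(0)^\alpha\tau<1$, such that if $L>2$, $T>0$ and $(\Omega_t)_{0\le t<T}$ is any barrier solution with $\Omega_0$ bounded and $B_1\times(-L,L)\subseteq\Omega_0\subseteq\overline B_1\times\mathbb R$, then $$B_{r(t)}\times(-(L-2),L-2)\subseteq\Omega_t\subseteq\overline B_{r(t)}\times\mathbb R\qquad\text{for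 all }t\in[0,\tau]\cap[0,T).$$ **(2)** Suppose in addition that $\hat f(0)>0$, and let $t_*=1/\bigl((1+\alpha)\hat f(0)^\alpha\bigr)$. There is $C>0$, depending only on $n,f,\alpha$, such that if $L>C$, $T>0$ and $(\Omega_t)_{0\le t<T}$ is any barrier solution with $\Omega_0$ bounded and $B_1\times(-L,L)\subseteq\Omega_0\subseteq\overline B_1\times\mathbb R$, then: (a) $\{0\}\times[-(L-C),L-C]\subseteq\Omega_t\subseteq\overline B_{r(t)}\times\mathbb R$ for all $t\in[0,T)$ with $t<t_*$; (b) if $\Omega_t$ has nonempty interior for all $t\in[0,T)$, then $T\le t_*$; (c) if $T\le t_*$, then $\partial\Omega_t$ does not converge to a point as $t\to T$; (d) if $t_*\le T$ and $\Omega_t$ is convex for all $t\in[0,t_*)$, then $\partial\Omega_t$ converges in Hausdorff distance, as $t\uparrow t_*$, to a segment $\{0\}\times[c,d]$ with $c\le-(L-C)$ and $d\ge L-C$. **(3)** For $n\ge2$ and every $\alpha>0$ the function $f(\kappa)=\bigl(\sum_i\kappa_i^2\bigr)^{1/2}$ (speed $|A|^\alpha$) satisfies all the above hypotheses on $f$,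 including $\int_0^1 dz/g^{-1}(z)<\infty$ and $\hat f(0)>0$. -/

import Mathlib

open Set Filter Topology MeasureTheory
open scoped ContDiff ENNReal

noncomputable section

/-- The space `ℝⁿ⁺¹ = ℝⁿ × ℝ`; the last coordinate is the axial coordinate. -/
abbrev AmbientSpace (n : ℕ) : Type := EuclideanSpace ℝ (Fin (n + 1))

/-- The open positive cone `Γ₊` in `ℝⁿ`. -/
def positiveCone (n : ℕ) : Set (Fin n → ℝ) := {κ | ∀ i, 0 < κ i}

/-- Speed functions: smooth, symmetric, strictly increasing in each argument, homogeneous of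
degree one and positive on the positive cone. No normalization of `f (1, …, 1)` is required.
Only the values of `f` on the positive cone matter. -/
structure IsSpeedFunction {n : ℕ} (f : (Fin n → ℝ) → ℝ) : Prop where
  smooth : ContDiffOn ℝ ∞ f (positiveCone n)
  symmetric : ∀ (σ : Equiv.Perm (Fin n)), ∀ κ ∈ positiveCone n, f (κ ∘ σ) = f κ
  increasing : ∀ κ ∈ positiveCone n, ∀ i, 0 < fderiv ℝ f κ (Pi.single i 1)
  homogeneous : ∀ c : ℝ, 0 < c → ∀ κ ∈ positiveCone n, f (c • κ) = c * f κ
  pos : ∀ κ ∈ positiveCone n, 0 < f κ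

/-- `f̂ x = f (x, 1, …, 1)` for `x ≥ 0`, where `f` is extended by continuity from the positive
cone to its closure (this is what gives the value at `x = 0`). -/
def fHat {n : ℕ} [NeZero n] (f : (Fin n → ℝ) → ℝ) (x : ℝ) : ℝ :=
  extendFrom (positiveCone n) f (Function.update (fun _ => 1) 0 x)

/-- `g x = f̂(x)^α - f̂(0)^α`. -/
def gFun {n : ℕ} [NeZero n] (f : (Fin n → ℝ) → ℝ) (α x : ℝ) : ℝ :=
  fHat f x ^ α - fHat f 0 ^ α

/-- The inverse `g⁻¹(z)` of the increasing function `g : [0, ∞) → [0, sup g)`, with the value `∞`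
at those `z` that lie above the range of `g`. -/
def gInv {n : ℕ} [NeZero n] (f : (Fin n → ℝ) → ℝ) (α z : ℝ) : ℝ≥0∞ :=
  ⨅ (x : ℝ) (_ : 0 ≤ x ∧ z ≤ gFun f α x), ENNReal.ofReal x

/-- The condition `∫₀¹ dz / g⁻¹(z) < ∞`. -/
def CylindricalDegeneracy {n : ℕ} [NeZero n] (f : (Fin n → ℝ) → ℝ) (α : ℝ) : Prop :=
  ∫⁻ z in Ioo (0 : ℝ) 1, (gInv f α z)⁻¹ < ⊤

/-- `κ` lists the principal curvatures at `x` of the level set of `φ` through `x`, with respect to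
the unit normal `∇φ / |∇φ|`: in a suitable orthonormal basis of the tangent space `(∇φ x)^⊥` the
second fundamental form `D²φ / |∇φ|` is diagonal with entries `κ`. The list is unique up to order.
With this sign the boundary of a convex region `{φ ≤ 0}` has nonnegative curvatures. -/
def IsPrincipalCurvatures {n : ℕ} (φ : AmbientSpace n → ℝ) (x : AmbientSpace n)
    (κ : Fin n → ℝ) : Prop :=
  ∃ e : Fin n → AmbientSpace n, Orthonormal ℝ e ∧
    (∀ i, inner ℝ (gradient φ x) (e i) = 0) ∧
    ∀ i j, fderiv ℝ (fderiv ℝ φ) x (e i) (e j) = if i = j then ‖gradient φ x‖ * κ i else 0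

/-- `φ` is a smooth defining function on the time interval `[a, b]` for the family `Ω` of closed
sets: `Ω t = {φ t ≤ 0}` and the spatial gradient of `φ` does not vanish on the boundary
`{φ t = 0}`. So each `Ω t` is a closed set with smooth boundary depending smoothly on `t`. -/
structure IsSmoothFamily {n : ℕ} (a b : ℝ) (φ : ℝ → AmbientSpace n → ℝ)
    (Ω : ℝ → Set (AmbientSpace n)) : Prop where
  smooth : ContDiffOn ℝ ∞ (fun p : ℝ × AmbientSpace n => φ p.1 p.2) (Icc a b ×ˢ univ)
  regular : ∀ t ∈ Icc a b, ∀ x, φ t x = 0 → gradient (φ t) x ≠ 0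
  eq_sublevel : ∀ t ∈ Icc a b, Ω t = {x | φ t x ≤ 0}

/-- The velocity, in the direction of the inward normal, of the moving boundary `{φ t = 0}` of
`{φ t ≤ 0}` at time `t ∈ [a, b]` and position `x`. -/
def inwardVelocity {n : ℕ} (a b : ℝ) (φ : ℝ → AmbientSpace n → ℝ) (t : ℝ)
    (x : AmbientSpace n) : ℝ :=
  derivWithin (fun s => φ s x) (Icc a b) t / ‖gradient (φ t) x‖

/-- Smooth subsolutions on `[a, b]` of the flow with inward normal speed `f(κ)^α`: the principal
curvatures of the boundary lie in the positive cone and the inward normal velocity is at least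
`f(κ)^α`. -/
def IsSmoothSubsolution {n : ℕ} (f : (Fin n → ℝ) → ℝ) (α a b : ℝ)
    (Ω : ℝ → Set (AmbientSpace n)) : Prop :=
  ∃ φ : ℝ → AmbientSpace n → ℝ, IsSmoothFamily a b φ Ω ∧
    ∀ t ∈ Icc a b, ∀ x, φ t x = 0 →
      ∃ κ ∈ positiveCone n, IsPrincipalCurvatures (φ t) x κ ∧
        f κ ^ α ≤ inwardVelocity a b φ t x

/-- Smooth supersolutions on `[a, b]`: the inward normal velocity is at most `f(κ)^α`. -/
def IsSmoothSupersolution {n : ℕ} (f : (Fin n → ℝ) → ℝ) (α a b : ℝ)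
    (Ω : ℝ → Set (AmbientSpace n)) : Prop :=
  ∃ φ : ℝ → AmbientSpace n → ℝ, IsSmoothFamily a b φ Ω ∧
    ∀ t ∈ Icc a b, ∀ x, φ t x = 0 →
      ∃ κ ∈ positiveCone n, IsPrincipalCurvatures (φ t) x κ ∧
        inwardVelocity a b φ t x ≤ f κ ^ α

/-- Outer barriers on the time interval `I`; a subset of `ℝⁿ⁺¹ × I` is given by its slices. -/
def IsOuterBarrier {n : ℕ} (f : (Fin n → ℝ) → ℝ) (α : ℝ) (I : Set ℝ)
    (A : ℝ → Set (AmbientSpace n)) : Prop :=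
  ∀ (a b : ℝ) (Ω : ℝ → Set (AmbientSpace n)), a < b → Icc a b ⊆ I →
    IsSmoothSubsolution f α a b Ω → Ω a ⊆ A a → ∀ t ∈ Icc a b, Ω t ⊆ A t

/-- Inner barriers on the time interval `I`. -/
def IsInnerBarrier {n : ℕ} (f : (Fin n → ℝ) → ℝ) (α : ℝ) (I : Set ℝ)
    (A : ℝ → Set (AmbientSpace n)) : Prop :=
  ∀ (a b : ℝ) (Ω : ℝ → Set (AmbientSpace n)), a < b → Icc a b ⊆ I →
    IsSmoothSupersolution f α a b Ω → A a ⊆ Ω a → ∀ t ∈ Icc a b, A t ⊆ Ω t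

/-- Barrier solutions on the time interval `I`. -/
def IsBarrierSolution {n : ℕ} (f : (Fin n → ℝ) → ℝ) (α : ℝ) (I : Set ℝ)
    (A : ℝ → Set (AmbientSpace n)) : Prop :=
  IsOuterBarrier f α I A ∧ IsInnerBarrier f α I A

/-- The open cylindrical piece `Bⁿ_r(0) × (-L, L)`, for `r ≥ 0`. -/
def openCylinder (n : ℕ) (r L : ℝ) : Set (AmbientSpace n) :=
  {x | ∑ i : Fin n, x i.castSucc ^ 2 < r ^ 2 ∧ x (Fin.last n) ∈ Ioo (-L) L}

/-- The closed infinite cylinder of radius `r ≥ 0` about the axis. -/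
def closedCylinder (n : ℕ) (r : ℝ) : Set (AmbientSpace n) :=
  {x | ∑ i : Fin n, x i.castSucc ^ 2 ≤ r ^ 2}

/-- The segment `{0} × [c, d]` on the axis. -/
def axisSegment (n : ℕ) (c d : ℝ) : Set (AmbientSpace n) :=
  {x | (∀ i : Fin n, x i.castSucc = 0) ∧ x (Fin.last n) ∈ Icc c d}

/-- The radius `r(t) = (1 - (1 + α) f̂(0)^α t)^{1/(1+α)}` of the shrinking cylinder. -/
def cylinderRadius {n : ℕ} [NeZero n] (f : (Fin n → ℝ) → ℝ) (α t : ℝ) : ℝ :=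
  (1 - (1 + α) * fHat f 0 ^ α * t) ^ (1 / (1 + α))

/-- The time `1 / ((1 + α) f̂(0)^α)` at which the radius of the shrinking cylinder reaches zero,
for `f̂(0) > 0`. -/
def collapseTime {n : ℕ} [NeZero n] (f : (Fin n → ℝ) → ℝ) (α : ℝ) : ℝ :=
  1 / ((1 + α) * fHat f 0 ^ α)

/-- The function `(∑ κᵢ²)^{1/2}`, which gives the norm `|A|` of the second fundamental form. -/
def secondFormNorm (n : ℕ) (κ : Fin n → ℝ) : ℝ := Real.sqrt (∑ i, κ i ^ 2)

end

/-!
The barriers are solids of revolution `|x|² ≤ R² (1 - v(y))` about the `y`-axis, for which the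
subsolution and supersolution conditions become one inequality between functions of `y`.

*Outer control.* Balls and thin ellipsoids with `R^(1+α) = Z - k t`, `k ≤ (1+α) f̂(0)^α`, are
supersolutions. They keep `Ω_t` bounded, inside the closed cylinder of radius `r(t)`, and make its
axial extent nonincreasing in time.

*Inner control.* The shrinking cylinder is closed up by a convex cap with slope `p(s)` along the
axis. The cap makes the axial curvature positive, of order `p'`, which raises the speed by about
`g(p')`, while moving the cap inwards contributes a multiple of `p` to the normal velocity. The
subsolution condition thus allows `p'` to be as large as `g⁻¹(p)`, and since `ds = dp / p'`, such a
cap has finite length when `∫ dz / g⁻¹(z)` converges. Hence the ends of a cylinder of radius `R`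
recede by at most `2R` during a time proportional to `R^(1+α)`, and summing over geometrically
decreasing radii bounds the total loss by a constant `C` up to the time `t_*`. A segment of the axis
therefore survives while the radius `r(t)` tends to zero.
-/

section OrthonormalFrames

open Module

variable {E : Type*} [NormedAddCommGroup E] [InnerProductSpace ℝ E]

lemma exists_orthonormalBasis_eq_norm_smul {ι : Type*} [Fintype ι] [LinearOrder ι]
    [LocallyFiniteOrderBot ι] [WellFoundedLT ι] [FiniteDimensional ℝ E]
    (h : finrank ℝ E = Fintype.card ι) (i : ι) (w : E) :
    ∃ B : OrthonormalBasis ι ℝ E, w = ‖w‖ • B i := by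
  have horth : Pairwise fun j k => inner ℝ (Pi.single (M := fun _ => E) i w j)
      (Pi.single (M := fun _ => E) i w k) = 0 := by
    intro j k hjk
    by_cases hj : j = i
    · simp [Pi.single_eq_of_ne (hj ▸ hjk.symm)]
    · simp [Pi.single_eq_of_ne hj]
  refine ⟨InnerProductSpace.gramSchmidtOrthonormalBasis h (Pi.single i w), ?_⟩
  by_cases hw : w = 0
  · simp [hw]
  · rw [InnerProductSpace.gramSchmidtOrthonormalBasis_apply_of_orthogonal h horth (by simpa),
      Pi.single_eq_same, RCLike.ofReal_real_eq_id, id, smul_smul,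
      mul_inv_cancel₀ (norm_ne_zero_iff.mpr hw), one_smul]

lemma exists_orthonormal_orthogonal_adapted {n : ℕ} [NeZero n] [Fact (finrank ℝ E = n + 1)]
    {ν : E} (hν : ‖ν‖ = 1) (b : E) :
    ∃ e : Fin n → E, Orthonormal ℝ e ∧ (∀ i, inner ℝ ν (e i) = 0) ∧
      (∀ i, i ≠ 0 → inner ℝ b (e i) = 0) ∧
      inner ℝ b (e 0) ^ 2 = ‖b‖ ^ 2 - inner ℝ ν b ^ 2 := by
  have : FiniteDimensional ℝ E := .of_fact_finrank_eq_succ n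
  have hν0 : ν ≠ 0 := norm_ne_zero_iff.mp (hν ▸ one_ne_zero)
  have hνν : inner ℝ ν ν = 1 := by rw [real_inner_self_eq_norm_sq, hν, one_pow]
  have hw : b - inner ℝ ν b • ν ∈ (ℝ ∙ ν)ᗮ := by
    rw [Submodule.mem_orthogonal_singleton_iff_inner_right, inner_sub_right, inner_smul_right,
      hνν, mul_one, sub_self]
  obtain ⟨B, hB⟩ := exists_orthonormalBasis_eq_norm_smul (ι := Fin n)
    (by rw [Submodule.finrank_orthogonal_span_singleton (n := n) hν0, Fintype.card_fin]) 0
    (⟨_, hw⟩ : (ℝ ∙ ν)ᗮ)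
  have hperp (i : Fin n) : inner ℝ ν (B i : E) = 0 :=
    Submodule.mem_orthogonal_singleton_iff_inner_right.mp (B i).2
  have hb (i : Fin n) : inner ℝ b (B i : E) = if i = 0 then ‖b - inner ℝ ν b • ν‖ else 0 := by
    have hbi : inner ℝ b (B i : E) = inner ℝ (⟨_, hw⟩ : (ℝ ∙ ν)ᗮ) (B i) := by
      rw [Submodule.coe_inner, inner_sub_left, inner_smul_left, hperp, mul_zero, sub_zero]
    rw [hbi, hB, inner_smul_left, orthonormal_iff_ite.mp B.orthonormal]
    by_cases hi : i = 0
    · simp [hi]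
    · simp [hi, Ne.symm hi]
  refine ⟨fun i => B i, B.orthonormal.comp_linearIsometry (ℝ ∙ ν)ᗮ.subtypeₗᵢ, hperp,
    fun i hi => by rw [hb, if_neg hi], ?_⟩
  rw [hb, if_pos rfl, norm_sub_sq_real, inner_smul_right, real_inner_comm, norm_smul, hν,
    mul_one, Real.norm_eq_abs, sq_abs]
  ring

end OrthonormalFrames

section AxialFunctions

variable {n : ℕ}

/-- The unit vector along the axis of `ℝⁿ × ℝ`. -/
noncomputable def axisVector (n : ℕ) : AmbientSpace n := EuclideanSpace.single (Fin.last n) 1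

lemma inner_axisVector (x : AmbientSpace n) : inner ℝ (axisVector n) x = x (Fin.last n) := by
  simp [axisVector, EuclideanSpace.inner_single_left]

lemma norm_axisVector (n : ℕ) : ‖axisVector n‖ = 1 := by simp [axisVector]

lemma axisVector_last (n : ℕ) : axisVector n (Fin.last n) = 1 := by simp [axisVector]

/-- The squared distance to the axis. -/
def radialSq (x : AmbientSpace n) : ℝ := ∑ i : Fin n, x i.castSucc ^ 2

lemma radialSq_nonneg (x : AmbientSpace n) : 0 ≤ radialSq x :=
  Finset.sum_nonneg fun _ _ => sq_nonneg _

lemma norm_sq_eq_radialSq_add (x : AmbientSpace n) :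
    ‖x‖ ^ 2 = radialSq x + x (Fin.last n) ^ 2 := by
  rw [EuclideanSpace.real_norm_sq_eq, Fin.sum_univ_castSucc, radialSq]

lemma radialSq_le_norm_sq (x : AmbientSpace n) : radialSq x ≤ ‖x‖ ^ 2 :=
  norm_sq_eq_radialSq_add x ▸ le_add_of_nonneg_right (sq_nonneg _)

lemma abs_last_le_norm (x : AmbientSpace n) : |x (Fin.last n)| ≤ ‖x‖ :=
  PiLp.norm_apply_le x (Fin.last n)

/-- The rotationally symmetric functions `A |x'|² + ψ(y)` of `(x', y) ∈ ℝⁿ × ℝ`; their level sets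
are the hypersurfaces of revolution with squared radius an affine function of `ψ`. -/
def axialFun (n : ℕ) (A : ℝ) (ψ : ℝ → ℝ) (x : AmbientSpace n) : ℝ :=
  A * radialSq x + ψ (x (Fin.last n))

lemma hasFDerivAt_last (x : AmbientSpace n) :
    HasFDerivAt (fun x : AmbientSpace n => x (Fin.last n)) (innerSL ℝ (axisVector n)) x := by
  simpa only [← inner_axisVector] using! (innerSL ℝ (axisVector n)).hasFDerivAt

lemma hasFDerivAt_radialSq (x : AmbientSpace n) :
    HasFDerivAt (radialSq (n := n))
      ((2 : ℝ) • (innerSL ℝ x - x (Fin.last n) • innerSL ℝ (axisVector n))) x := by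
  have hr : radialSq (n := n) = fun x => ‖x‖ ^ 2 - x (Fin.last n) ^ 2 :=
    funext fun x => eq_sub_of_add_eq (norm_sq_eq_radialSq_add x).symm
  rw [hr]
  refine ((hasStrictFDerivAt_norm_sq x).hasFDerivAt.sub
    ((hasFDerivAt_last x).pow 2)).congr_fderiv ?_
  ext z
  simp only [Nat.add_one_sub_one, pow_one, nsmul_eq_mul, Nat.cast_ofNat,
    sub_apply, smul_apply, coe_innerSL_apply, smul_eq_mul]
  ring

variable {A : ℝ} {ψ ψ₁ ψ₂ : ℝ → ℝ}

lemma hasFDerivAt_axialFun (h₁ : ∀ y, HasDerivAt ψ (ψ₁ y) y) (x : AmbientSpace n) :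
    HasFDerivAt (axialFun n A ψ) ((2 * A) • innerSL ℝ x +
      (ψ₁ (x (Fin.last n)) - 2 * A * x (Fin.last n)) • innerSL ℝ (axisVector n)) x := by
  refine (((hasFDerivAt_radialSq x).const_mul A).add
    ((h₁ (x (Fin.last n))).comp_hasFDerivAt x (hasFDerivAt_last x))).congr_fderiv ?_
  ext z
  simp only [add_apply, smul_apply, sub_apply, coe_innerSL_apply, smul_eq_mul]
  ring

lemma gradient_axialFun (h₁ : ∀ y, HasDerivAt ψ (ψ₁ y) y) (x : AmbientSpace n) :
    gradient (axialFun n A ψ) x =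
      (2 * A) • x + (ψ₁ (x (Fin.last n)) - 2 * A * x (Fin.last n)) • axisVector n := by
  refine (hasGradientAt_iff_hasFDerivAt.mpr
    ((hasFDerivAt_axialFun h₁ x).congr_fderiv ?_)).gradient
  ext z
  simp

lemma inner_gradient_axialFun_axisVector (h₁ : ∀ y, HasDerivAt ψ (ψ₁ y) y)
    (x : AmbientSpace n) :
    inner ℝ (gradient (axialFun n A ψ) x) (axisVector n) = ψ₁ (x (Fin.last n)) := by
  rw [real_inner_comm, inner_axisVector, gradient_axialFun h₁]
  simp [axisVector_last]

lemma norm_sq_gradient_axialFun (h₁ : ∀ y, HasDerivAt ψ (ψ₁ y) y) (x : AmbientSpace n) :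
    ‖gradient (axialFun n A ψ) x‖ ^ 2 = 4 * A ^ 2 * radialSq x + ψ₁ (x (Fin.last n)) ^ 2 := by
  rw [gradient_axialFun h₁, norm_add_sq_real, norm_smul, norm_smul, mul_pow, mul_pow,
    norm_axisVector, norm_sq_eq_radialSq_add, inner_smul_left, inner_smul_right, real_inner_comm,
    inner_axisVector]
  simp only [Real.norm_eq_abs, sq_abs, conj_trivial]
  ring

lemma fderiv_fderiv_axialFun (h₁ : ∀ y, HasDerivAt ψ (ψ₁ y) y)
    (h₂ : ∀ y, HasDerivAt ψ₁ (ψ₂ y) y) (x u w : AmbientSpace n) :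
    fderiv ℝ (fderiv ℝ (axialFun n A ψ)) x u w = 2 * A * inner ℝ u w +
      (ψ₂ (x (Fin.last n)) - 2 * A) * (inner ℝ (axisVector n) u * inner ℝ (axisVector n) w) := by
  have hfderiv : fderiv ℝ (axialFun n A ψ) = fun x => (2 * A) • innerSL ℝ x +
      (ψ₁ (x (Fin.last n)) - 2 * A * x (Fin.last n)) • innerSL ℝ (axisVector n) :=
    funext fun x => (hasFDerivAt_axialFun h₁ x).fderiv
  have hcoeff : HasFDerivAt (fun x : AmbientSpace n =>
      ψ₁ (x (Fin.last n)) - 2 * A * x (Fin.last n)) _ x :=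
    ((h₂ (x (Fin.last n))).comp_hasFDerivAt x (hasFDerivAt_last x)).sub
      ((hasFDerivAt_last x).const_mul (2 * A))
  have hmain : HasFDerivAt (fun x => (2 * A) • innerSL ℝ x +
      (ψ₁ (x (Fin.last n)) - 2 * A * x (Fin.last n)) • innerSL ℝ (axisVector n)) _ x :=
    ((innerSL ℝ (E := AmbientSpace n)).hasFDerivAt.const_smul (2 * A)).add
      (hcoeff.smul_const (innerSL ℝ (axisVector n)))
  rw [hfderiv, hmain.fderiv]
  change (2 * A) * inner ℝ u w + _ = _
  simp only [ContinuousLinearMap.coe_smulRight, ContinuousLinearMap.toLinearMap_sub,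
    ContinuousLinearMap.toLinearMap_smul, ContinuousLinearMap.toLinearMap_innerSL_apply,
    LinearMap.coe_smulRight, LinearMap.sub_apply, LinearMap.smul_apply, innerₛₗ_apply_apply,
    smul_eq_mul, add_right_inj]
  ring

-- The rotational curvatures are `2A / |∇φ|`; the axial one is read off on the tangent line that
-- lies in the plane through the axis.
lemma isPrincipalCurvatures_axialFun [NeZero n] (h₁ : ∀ y, HasDerivAt ψ (ψ₁ y) y)
    (h₂ : ∀ y, HasDerivAt ψ₁ (ψ₂ y) y) {x : AmbientSpace n} {N : ℝ} (hN : 0 < N)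
    (hNx : N ^ 2 = 4 * A ^ 2 * radialSq x + ψ₁ (x (Fin.last n)) ^ 2) :
    IsPrincipalCurvatures (axialFun n A ψ) x (Function.update (fun _ => 2 * A / N) 0
      ((2 * A * ψ₁ (x (Fin.last n)) ^ 2 +
        4 * A ^ 2 * radialSq x * ψ₂ (x (Fin.last n))) / N ^ 3)) := by
  set G := gradient (axialFun n A ψ) x with hG
  have hGN : ‖G‖ = N := (pow_left_inj₀ (norm_nonneg _) hN.le two_ne_zero).mp
    ((norm_sq_gradient_axialFun h₁ x).trans hNx.symm)
  have : Fact (Module.finrank ℝ (AmbientSpace n) = n + 1) := ⟨by simp⟩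
  obtain ⟨e, he, hνe, hbe, hbe0⟩ := exists_orthonormal_orthogonal_adapted (n := n) (ν := N⁻¹ • G)
    (by rw [norm_smul, hGN, norm_inv, Real.norm_of_nonneg hN.le, inv_mul_cancel₀ hN.ne'])
    (axisVector n)
  have hGe (i : Fin n) : inner ℝ G (e i) = 0 := by
    simpa [inner_smul_left, hN.ne'] using hνe i
  have haxial : inner ℝ (axisVector n) (e 0) * inner ℝ (axisVector n) (e 0) =
      4 * A ^ 2 * radialSq x / N ^ 2 := by
    rw [← sq, hbe0, norm_axisVector, inner_smul_left, hG, inner_gradient_axialFun_axisVector h₁,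
      conj_trivial, eq_div_iff (by positivity)]
    field_simp
    linarith
  refine ⟨e, he, hGe, fun i j => ?_⟩
  rw [fderiv_fderiv_axialFun h₁ h₂, orthonormal_iff_ite.mp he i j, hGN]
  rcases eq_or_ne i j with rfl | hij
  · rcases eq_or_ne i 0 with rfl | hi
    · simp only [haxial, if_true, Function.update_self]
      field_simp
      linear_combination (2 * A) * hNx
    · simp only [hbe i hi, if_true, Function.update_of_ne hi]
      field_simp
      ring
  · have hzero : inner ℝ (axisVector n) (e i) * inner ℝ (axisVector n) (e j) = 0 := by
      rcases eq_or_ne i 0 with rfl | hi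
      · rw [hbe j hij.symm, mul_zero]
      · rw [hbe i hi, zero_mul]
    simp only [if_neg hij, hzero, mul_zero, add_zero]

end AxialFunctions

section SpeedFunction

variable {n : ℕ} {f : (Fin n → ℝ) → ℝ}

lemma positiveCone_eq_pi (n : ℕ) : positiveCone n = univ.pi fun _ => Ioi 0 := by
  ext κ
  simp [positiveCone]

lemma isOpen_positiveCone (n : ℕ) : IsOpen (positiveCone n) :=
  positiveCone_eq_pi n ▸ isOpen_set_pi finite_univ fun _ _ => isOpen_Ioi

lemma convex_positiveCone (n : ℕ) : Convex ℝ (positiveCone n) :=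
  positiveCone_eq_pi n ▸ convex_pi fun _ _ => convex_Ioi 0

lemma IsSpeedFunction.fderiv_nonneg (hf : IsSpeedFunction f) {κ v : Fin n → ℝ}
    (hκ : κ ∈ positiveCone n) (hv : 0 ≤ v) : 0 ≤ fderiv ℝ f κ v := by
  have hsum : v = ∑ i, v i • Pi.single i (1 : ℝ) := by
    ext j
    simp [Finset.sum_apply, Pi.single_apply]
  rw [hsum, map_sum]
  refine Finset.sum_nonneg fun i _ => ?_
  rw [map_smul, smul_eq_mul]
  exact mul_nonneg (hv i) (hf.increasing κ hκ i).le

lemma IsSpeedFunction.mono (hf : IsSpeedFunction f) {κ κ' : Fin n → ℝ} (hκ : κ ∈ positiveCone n)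
    (h : κ ≤ κ') : f κ ≤ f κ' := by
  have hderiv : ∀ x ∈ positiveCone n, HasFDerivWithinAt f (fderiv ℝ f x) (positiveCone n) x :=
    fun x hx => ((hf.smooth.contDiffAt ((isOpen_positiveCone n).mem_nhds hx)).differentiableAt
      (by simp)).hasFDerivAt.hasFDerivWithinAt
  have hκ' : κ' ∈ positiveCone n := fun i => (hκ i).trans_le (h i)
  obtain ⟨z, hz, hfz⟩ := domain_mvt hderiv (convex_positiveCone n) hκ hκ'
  rw [← sub_nonneg, hfz]
  exact hf.fderiv_nonneg ((convex_positiveCone n).segment_subset hκ hκ' hz) (sub_nonneg.mpr h)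

variable [NeZero n]

lemma update_mem_positiveCone {x c : ℝ} (hx : 0 < x) (hc : 0 < c) :
    Function.update (fun _ => c) (0 : Fin n) x ∈ positiveCone n := by
  intro i
  rcases eq_or_ne i 0 with rfl | hi
  · simpa using hx
  · simpa [hi] using hc

lemma IsSpeedFunction.apply_update_mul (hf : IsSpeedFunction f) {c x : ℝ} (hc : 0 < c)
    (hx : 0 < x) : f (Function.update (fun _ => c) 0 (c * x)) =
      c * f (Function.update (fun _ => 1) 0 x) := by
  rw [← hf.homogeneous c hc _ (update_mem_positiveCone hx one_pos)]
  congr 1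
  ext i
  rcases eq_or_ne i 0 with rfl | hi
  · simp
  · simp [hi]

lemma IsSpeedFunction.mul_apply_update_le (hf : IsSpeedFunction f) {c x : ℝ} {κ : Fin n → ℝ}
    (hc : 0 < c) (hx : 0 < x) (hκ₀ : c * x ≤ κ 0) (hκ : ∀ i ≠ 0, c ≤ κ i) :
    c * f (Function.update (fun _ => 1) 0 x) ≤ f κ := by
  rw [← hf.apply_update_mul hc hx]
  exact hf.mono (update_mem_positiveCone (mul_pos hc hx) hc) (update_le_iff.mpr ⟨hκ₀, hκ⟩)

lemma IsSpeedFunction.le_mul_apply_update (hf : IsSpeedFunction f) {c x : ℝ} {κ : Fin n → ℝ}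
    (hκ : κ ∈ positiveCone n) (hc : 0 < c) (hκ₀ : κ 0 ≤ c * x) (hκc : ∀ i ≠ 0, κ i ≤ c) :
    f κ ≤ c * f (Function.update (fun _ => 1) 0 x) := by
  have hx : 0 < x := pos_of_mul_pos_right ((hκ 0).trans_le hκ₀) hc.le
  rw [← hf.apply_update_mul hc hx]
  exact hf.mono hκ (le_update_iff.mpr ⟨hκ₀, hκc⟩)

-- Homogeneity and monotonicity squeeze `f` near the boundary point `(0, 1, …, 1)` between
-- multiples, by factors close to `1`, of its values on the line `(x, 1, …, 1)`.
lemma IsSpeedFunction.tendsto_sInf (hf : IsSpeedFunction f) :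
    Tendsto f (𝓝[positiveCone n] (Function.update (fun _ => 1) 0 0))
      (𝓝 (sInf ((fun x => f (Function.update (fun _ => 1) 0 x)) '' Ioi 0))) := by
  set φ : ℝ → ℝ := fun x => f (Function.update (fun _ => 1) 0 x)
  have hbdd : BddBelow (φ '' Ioi 0) :=
    ⟨0, forall_mem_image.mpr fun x hx => (hf.pos _ (update_mem_positiveCone hx one_pos)).le⟩
  have hcoord (i : Fin n) : Tendsto (fun κ : Fin n → ℝ => κ i)
      (𝓝[positiveCone n] (Function.update (fun _ => 1) 0 0))
      (𝓝 (Function.update (fun _ => (1 : ℝ)) 0 0 i)) :=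
    (continuous_apply i).continuousAt.tendsto.mono_left nhdsWithin_le_nhds
  have hone {i : Fin n} (hi : i ≠ 0) : Function.update (fun _ => (1 : ℝ)) 0 0 i = 1 :=
    Function.update_of_ne hi ..
  refine tendsto_order.mpr ⟨fun a ha => ?_, fun a ha => ?_⟩
  · have hlim : Tendsto (fun c : ℝ => c * sInf (φ '' Ioi 0)) (𝓝[<] 1) (𝓝 (sInf (φ '' Ioi 0))) := by
      simpa using (tendsto_id.mul_const _).mono_left (nhdsWithin_le_nhds (a := (1 : ℝ)))
    obtain ⟨c, hca, hc0, hc1⟩ :=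
      ((hlim.eventually_const_lt ha).and (Ioo_mem_nhdsLT zero_lt_one)).exists
    filter_upwards [self_mem_nhdsWithin, eventually_all.mpr fun i : Fin n =>
      eventually_imp_distrib_left.mpr fun hi : i ≠ 0 =>
        (hcoord i).eventually_const_lt (hc1.trans_eq (hone hi).symm)] with κ hκ hcκ
    refine hca.trans_le ((mul_le_mul_of_nonneg_left (csInf_le hbdd ?_) hc0.le).trans
      (hf.mul_apply_update_le hc0 (div_pos (hκ 0) hc0) (mul_div_cancel₀ _ hc0.ne').le
        fun i hi => (hcκ i hi).le))
    exact mem_image_of_mem φ (div_pos (hκ 0) hc0)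
  · obtain ⟨_, ⟨x, hx, rfl⟩, hxa⟩ := exists_lt_of_csInf_lt (nonempty_Ioi.image φ) ha
    have hlim : Tendsto (fun c : ℝ => c * φ x) (𝓝[>] 1) (𝓝 (φ x)) := by
      simpa using (tendsto_id.mul_const _).mono_left (nhdsWithin_le_nhds (a := (1 : ℝ)))
    obtain ⟨c, hca, hc1⟩ := ((hlim.eventually_lt_const hxa).and self_mem_nhdsWithin).exists
    filter_upwards [self_mem_nhdsWithin, (hcoord 0).eventually_lt_const (by simpa using hx),
      eventually_all.mpr fun i : Fin n => eventually_imp_distrib_left.mpr fun hi : i ≠ 0 =>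
        (hcoord i).eventually_lt_const ((hone hi).trans_lt hc1)] with κ hκ hκx hκc
    exact (hf.le_mul_apply_update hκ (zero_lt_one.trans hc1)
      (hκx.le.trans (le_mul_of_one_le_left hx.le hc1.le)) fun i hi => (hκc i hi).le).trans_lt hca

lemma update_one_mem_closure_positiveCone {x : ℝ} (hx : 0 ≤ x) :
    Function.update (fun _ => 1) (0 : Fin n) x ∈ closure (positiveCone n) := by
  rw [positiveCone_eq_pi, closure_pi_set, mem_univ_pi]
  intro i
  rw [closure_Ioi]
  rcases eq_or_ne i 0 with rfl | hi
  · simpa using hx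
  · simp [hi]

lemma fHat_eq_of_continuousAt {x : ℝ} (hx : 0 ≤ x)
    (h : ContinuousAt f (Function.update (fun _ => 1) 0 x)) :
    fHat f x = f (Function.update (fun _ => 1) 0 x) :=
  extendFrom_eq (update_one_mem_closure_positiveCone hx) (h.tendsto.mono_left nhdsWithin_le_nhds)

namespace IsSpeedFunction

lemma fHat_of_pos (hf : IsSpeedFunction f) {x : ℝ} (hx : 0 < x) :
    fHat f x = f (Function.update (fun _ => 1) 0 x) :=
  fHat_eq_of_continuousAt hx.le (hf.smooth.continuousOn.continuousAt
    ((isOpen_positiveCone n).mem_nhds (update_mem_positiveCone hx one_pos)))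

lemma fHat_pos (hf : IsSpeedFunction f) {x : ℝ} (hx : 0 < x) : 0 < fHat f x :=
  hf.fHat_of_pos hx ▸ hf.pos _ (update_mem_positiveCone hx one_pos)

lemma fHat_zero (hf : IsSpeedFunction f) : fHat f 0 = sInf (fHat f '' Ioi 0) := by
  have himage : fHat f '' Ioi 0 = (fun x => f (Function.update (fun _ => 1) 0 x)) '' Ioi 0 :=
    image_congr fun x hx => hf.fHat_of_pos hx
  rw [himage]
  exact extendFrom_eq (update_one_mem_closure_positiveCone le_rfl) hf.tendsto_sInf

lemma fHat_zero_nonneg (hf : IsSpeedFunction f) : 0 ≤ fHat f 0 := by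
  rw [hf.fHat_zero]
  exact Real.sInf_nonneg (forall_mem_image.mpr fun x hx => (hf.fHat_pos hx).le)

lemma fHat_mono (hf : IsSpeedFunction f) {x y : ℝ} (hx : 0 ≤ x) (hxy : x ≤ y) :
    fHat f x ≤ fHat f y := by
  rcases hx.eq_or_lt with rfl | hx
  · rcases hxy.eq_or_lt with rfl | hy
    · exact le_rfl
    · rw [hf.fHat_zero]
      exact csInf_le ⟨0, forall_mem_image.mpr fun x hx => (hf.fHat_pos hx).le⟩
        (mem_image_of_mem _ hy)
  · rw [hf.fHat_of_pos hx, hf.fHat_of_pos (hx.trans_le hxy)]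
    exact hf.mono (update_mem_positiveCone hx one_pos)
      (update_le_update_iff.mpr ⟨hxy, fun _ _ => le_rfl⟩)

lemma fHat_nonneg (hf : IsSpeedFunction f) {x : ℝ} (hx : 0 ≤ x) : 0 ≤ fHat f x :=
  hf.fHat_zero_nonneg.trans (hf.fHat_mono le_rfl hx)

lemma apply_update_mul_eq_fHat (hf : IsSpeedFunction f) {c x : ℝ} (hc : 0 < c) (hx : 0 < x) :
    f (Function.update (fun _ => c) 0 (c * x)) = c * fHat f x := by
  rw [hf.fHat_of_pos hx, hf.apply_update_mul hc hx]

end IsSpeedFunction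

end SpeedFunction

section ProfileFamilies

/-- The solid of revolution whose squared radius at height `y` is `r² (1 - v y)`. -/
def solidOfRevolution (n : ℕ) (r : ℝ) (v : ℝ → ℝ) : Set (AmbientSpace n) :=
  {x | radialSq x / r ^ 2 + v (x (Fin.last n)) ≤ 1}

/-- A smooth one-parameter family of profiles `(R, v)` for which the solids of revolution
`solidOfRevolution n (R t) (v t)` are strictly convex with smooth boundary. The derivatives of `R`
and `v` are part of the data, so that the boundary curvatures and velocities can be given by
formulas. -/
structure ProfileFamily (a b : ℝ) where
  R : ℝ → ℝ
  R' : ℝ → ℝ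
  v : ℝ → ℝ → ℝ
  v₁ : ℝ → ℝ → ℝ
  v₂ : ℝ → ℝ → ℝ
  vₜ : ℝ → ℝ → ℝ
  lt : a < b
  pos : ∀ t ∈ Icc a b, 0 < R t
  smooth_radius : ContDiffOn ℝ ∞ R (Icc a b)
  deriv_radius : ∀ t ∈ Icc a b, HasDerivWithinAt R (R' t) (Icc a b) t
  smooth : ContDiffOn ℝ ∞ (fun p : ℝ × ℝ => v p.1 p.2) (Icc a b ×ˢ univ)
  deriv_one : ∀ t ∈ Icc a b, ∀ y, HasDerivAt (v t) (v₁ t y) y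
  deriv_two : ∀ t ∈ Icc a b, ∀ y, HasDerivAt (v₁ t) (v₂ t y) y
  deriv_time : ∀ t ∈ Icc a b, ∀ y, HasDerivWithinAt (fun s => v s y) (vₜ t y) (Icc a b) t
  convex : ∀ t ∈ Icc a b, ∀ y, 0 < v₂ t y
  regular : ∀ t ∈ Icc a b, ∀ y, v t y = 1 → v₁ t y ≠ 0

/-- The squared length `1 - v + R² v_y² / 4` of the normal to the profile, rescaled by `R / 2`. -/
noncomputable def normalSq (R v v₁ : ℝ) : ℝ := 1 - v + R ^ 2 * v₁ ^ 2 / 4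

/-- The ratio of the axial to the rotational principal curvature. -/
noncomputable def curvatureRatio (R v v₁ v₂ : ℝ) : ℝ :=
  (R ^ 2 * v₁ ^ 2 / 4 + R ^ 2 * v₂ * (1 - v) / 2) / normalSq R v v₁

namespace ProfileFamily

variable {a b : ℝ} (H : ProfileFamily a b) {n : ℕ} {t y : ℝ}

/-- The defining function of the family of solids of revolution. -/
noncomputable def definingFun (n : ℕ) (t : ℝ) : AmbientSpace n → ℝ :=
  axialFun n (H.R t ^ 2)⁻¹ fun y => H.v t y - 1

/-- `normalSq` of the profile at time `t` and height `y`. -/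
noncomputable def normalSq (t y : ℝ) : ℝ := _root_.normalSq (H.R t) (H.v t y) (H.v₁ t y)

/-- `curvatureRatio` of the profile at time `t` and height `y`. -/
noncomputable def curvatureRatio (t y : ℝ) : ℝ :=
  _root_.curvatureRatio (H.R t) (H.v t y) (H.v₁ t y) (H.v₂ t y)

/-- The speed `f(κ)^α` at height `y`, multiplied by `R^α` and the length of the rescaled normal. -/
noncomputable def rescaledSpeed [NeZero n] (f : (Fin n → ℝ) → ℝ) (α t y : ℝ) : ℝ :=
  H.normalSq t y ^ ((1 - α) / 2) * fHat f (H.curvatureRatio t y) ^ α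

/-- The inward velocity at height `y`, multiplied by `R^α` and the length of the rescaled
normal. -/
noncomputable def rescaledVelocity (α t y : ℝ) : ℝ :=
  H.R t ^ α * (-H.R' t * (1 - H.v t y) + H.R t * H.vₜ t y / 2)

lemma normalSq_pos (ht : t ∈ Icc a b) (hy : H.v t y ≤ 1) : 0 < H.normalSq t y := by
  have hR := H.pos t ht
  rcases hy.lt_or_eq with h | h
  · exact add_pos_of_pos_of_nonneg (sub_pos.mpr h) (by positivity)
  · have := H.regular t ht y h
    exact add_pos_of_nonneg_of_pos (sub_nonneg.mpr hy) (by positivity)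

lemma curvatureRatio_pos (ht : t ∈ Icc a b) (hy : H.v t y ≤ 1) : 0 < H.curvatureRatio t y := by
  have hR := H.pos t ht
  have hconvex := H.convex t ht y
  have : 0 ≤ 1 - H.v t y := sub_nonneg.mpr hy
  refine div_pos ?_ (H.normalSq_pos ht hy)
  rcases hy.lt_or_eq with h | h
  · have : 0 < 1 - H.v t y := sub_pos.mpr h
    positivity
  · have := H.regular t ht y h
    positivity

section Boundary

variable {x : AmbientSpace n}

lemma radialSq_eq (ht : t ∈ Icc a b) (hx : H.definingFun n t x = 0) :
    radialSq x = H.R t ^ 2 * (1 - H.v t (x (Fin.last n))) := by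
  have hR := (H.pos t ht).ne'
  rw [definingFun, axialFun] at hx
  field_simp at hx
  linarith

lemma v_le_one (hx : H.definingFun n t x = 0) : H.v t (x (Fin.last n)) ≤ 1 := by
  have hnonneg : 0 ≤ (H.R t ^ 2)⁻¹ * radialSq x := mul_nonneg (by positivity) (radialSq_nonneg x)
  rw [definingFun, axialFun] at hx
  linarith

lemma norm_gradient_sq (ht : t ∈ Icc a b) (hx : H.definingFun n t x = 0) :
    (2 / H.R t * √(H.normalSq t (x (Fin.last n)))) ^ 2 =
      4 * (H.R t ^ 2)⁻¹ ^ 2 * radialSq x + H.v₁ t (x (Fin.last n)) ^ 2 := by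
  have hR := H.pos t ht
  rw [mul_pow, Real.sq_sqrt (H.normalSq_pos ht (H.v_le_one hx)).le, H.radialSq_eq ht hx, normalSq,
    _root_.normalSq]
  field_simp
  ring

lemma norm_gradient (ht : t ∈ Icc a b) (hx : H.definingFun n t x = 0) :
    ‖gradient (H.definingFun n t) x‖ = 2 / H.R t * √(H.normalSq t (x (Fin.last n))) := by
  have hR := H.pos t ht
  refine (pow_left_inj₀ (norm_nonneg _) (by positivity) two_ne_zero).mp ?_
  rw [H.norm_gradient_sq ht hx, definingFun,
    norm_sq_gradient_axialFun fun y => (H.deriv_one t ht y).sub_const 1]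

lemma contDiffOn_definingFun (n : ℕ) :
    ContDiffOn ℝ ∞ (fun p : ℝ × AmbientSpace n => H.definingFun n p.1 p.2)
      (Icc a b ×ˢ univ) := by
  have hlast : ContDiff ℝ ∞ fun p : ℝ × AmbientSpace n => p.2 (Fin.last n) := by
    fun_prop
  have hradial : ContDiff ℝ ∞ fun p : ℝ × AmbientSpace n => radialSq p.2 := by
    unfold radialSq
    fun_prop
  have hR : ContDiffOn ℝ ∞ (fun p : ℝ × AmbientSpace n => (H.R p.1 ^ 2)⁻¹) (Icc a b ×ˢ univ) :=
    ((H.smooth_radius.comp contDiffOn_fst fun p hp => hp.1).pow 2).inv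
      fun p hp => (pow_pos (H.pos _ hp.1) 2).ne'
  have hv : ContDiffOn ℝ ∞ (fun p : ℝ × AmbientSpace n => H.v p.1 (p.2 (Fin.last n)))
      (Icc a b ×ˢ univ) :=
    H.smooth.comp (contDiffOn_fst.prodMk hlast.contDiffOn) fun p hp => ⟨hp.1, mem_univ _⟩
  exact (hR.mul hradial.contDiffOn).add (hv.sub contDiffOn_const)

lemma isSmoothFamily (n : ℕ) : IsSmoothFamily a b (H.definingFun n)
    fun t => solidOfRevolution n (H.R t) (H.v t) where
  smooth := H.contDiffOn_definingFun n
  regular t ht x hx := by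
    have hR := H.pos t ht
    have hN := H.normalSq_pos ht (H.v_le_one hx)
    rw [← norm_pos_iff, H.norm_gradient ht hx]
    positivity
  eq_sublevel t _ := by
    ext x
    rw [solidOfRevolution, mem_ofPred_eq, mem_ofPred_eq, definingFun, axialFun, inv_mul_eq_div,
      ← add_sub_assoc, sub_nonpos]

lemma inwardVelocity_eq (α : ℝ) (ht : t ∈ Icc a b) (hx : H.definingFun n t x = 0) :
    inwardVelocity a b (H.definingFun n) t x =
      H.rescaledVelocity α t (x (Fin.last n)) /
        (H.R t ^ α * √(H.normalSq t (x (Fin.last n)))) := by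
  have hR := H.pos t ht
  have hderiv : HasDerivWithinAt (fun s => H.definingFun n s x)
      (-(2 * H.R t * H.R' t) / (H.R t ^ 2) ^ 2 * radialSq x + H.vₜ t (x (Fin.last n)))
      (Icc a b) t := by
    refine ((((H.deriv_radius t ht).pow 2).inv (pow_pos hR 2).ne').mul_const (radialSq x)).add
      ((H.deriv_time t ht (x (Fin.last n))).sub_const 1) |>.congr_deriv ?_
    simp
  have hN : 0 < √(H.normalSq t (x (Fin.last n))) :=
    Real.sqrt_pos.mpr (H.normalSq_pos ht (H.v_le_one hx))
  have : 0 < H.R t ^ α := Real.rpow_pos_of_pos hR α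
  rw [inwardVelocity, hderiv.derivWithin (uniqueDiffOn_Icc H.lt t ht), H.norm_gradient ht hx,
    H.radialSq_eq ht hx, rescaledVelocity]
  field_simp

variable [NeZero n] {f : (Fin n → ℝ) → ℝ} {α : ℝ}

lemma isPrincipalCurvatures_definingFun (ht : t ∈ Icc a b) (hx : H.definingFun n t x = 0) :
    IsPrincipalCurvatures (H.definingFun n t) x
      (Function.update (fun _ => (H.R t * √(H.normalSq t (x (Fin.last n))))⁻¹) 0
        ((H.R t * √(H.normalSq t (x (Fin.last n))))⁻¹ *
          H.curvatureRatio t (x (Fin.last n)))) := by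
  have hR := H.pos t ht
  have hN := H.normalSq_pos ht (H.v_le_one hx)
  have hcurv := isPrincipalCurvatures_axialFun (fun y => (H.deriv_one t ht y).sub_const 1)
    (H.deriv_two t ht) (by positivity) (H.norm_gradient_sq ht hx)
  rw [H.radialSq_eq ht hx] at hcurv
  set N := H.normalSq t (x (Fin.last n)) with hNdef
  have hcube : √N ^ 3 = √N * N := by rw [pow_succ, Real.sq_sqrt hN.le, mul_comm]
  convert hcurv using 2
  · rfl
  · field_simp
  · rw [curvatureRatio, _root_.curvatureRatio, ← normalSq, ← hNdef, mul_pow, hcube]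
    field_simp
    ring

lemma exists_isPrincipalCurvatures (hf : IsSpeedFunction f) (α : ℝ) (ht : t ∈ Icc a b)
    (hx : H.definingFun n t x = 0) :
    ∃ κ ∈ positiveCone n, IsPrincipalCurvatures (H.definingFun n t) x κ ∧
      f κ ^ α = H.rescaledSpeed f α t (x (Fin.last n)) /
        (H.R t ^ α * √(H.normalSq t (x (Fin.last n)))) := by
  have hR := H.pos t ht
  have hN := H.normalSq_pos ht (H.v_le_one hx)
  have hratio := H.curvatureRatio_pos ht (H.v_le_one hx)
  have hc : 0 < (H.R t * √(H.normalSq t (x (Fin.last n))))⁻¹ := by positivity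
  refine ⟨_, update_mem_positiveCone (mul_pos hc hratio) hc,
    H.isPrincipalCurvatures_definingFun ht hx, ?_⟩
  rw [hf.apply_update_mul_eq_fHat hc hratio, rescaledSpeed,
    Real.mul_rpow hc.le (hf.fHat_nonneg hratio.le), Real.inv_rpow (by positivity),
    Real.mul_rpow hR.le (Real.sqrt_nonneg _), Real.sqrt_eq_rpow, ← Real.rpow_mul hN.le, sub_div,
    Real.rpow_sub hN, one_div_mul_eq_div]
  field_simp

end Boundary

variable [NeZero n] {f : (Fin n → ℝ) → ℝ} {α : ℝ}

lemma isSmoothSubsolution (hf : IsSpeedFunction f)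
    (h : ∀ t ∈ Icc a b, ∀ y, H.v t y ≤ 1 → H.rescaledSpeed f α t y ≤ H.rescaledVelocity α t y) :
    IsSmoothSubsolution f α a b fun t => solidOfRevolution n (H.R t) (H.v t) := by
  refine ⟨H.definingFun n, H.isSmoothFamily n, fun t ht x hx => ?_⟩
  obtain ⟨κ, hκ, hcurv, hspeed⟩ := H.exists_isPrincipalCurvatures hf α ht hx
  refine ⟨κ, hκ, hcurv, ?_⟩
  have hR := H.pos t ht
  rw [hspeed, H.inwardVelocity_eq α ht hx]
  gcongr
  exact h t ht _ (H.v_le_one hx)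

lemma isSmoothSupersolution (hf : IsSpeedFunction f)
    (h : ∀ t ∈ Icc a b, ∀ y, H.v t y ≤ 1 → H.rescaledVelocity α t y ≤ H.rescaledSpeed f α t y) :
    IsSmoothSupersolution f α a b fun t => solidOfRevolution n (H.R t) (H.v t) := by
  refine ⟨H.definingFun n, H.isSmoothFamily n, fun t ht x hx => ?_⟩
  obtain ⟨κ, hκ, hcurv, hspeed⟩ := H.exists_isPrincipalCurvatures hf α ht hx
  refine ⟨κ, hκ, hcurv, ?_⟩
  have hR := H.pos t ht
  rw [hspeed, H.inwardVelocity_eq α ht hx]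
  gcongr
  exact h t ht _ (H.v_le_one hx)

end ProfileFamily

end ProfileFamilies

section ShrinkingRadius

variable {α Z k a b t : ℝ}

/-- The radius at time `t` of a shrinking cylinder with `R ^ (1 + α) = Z - k * (t - a)`. -/
noncomputable def shrinkingRadius (α Z k a t : ℝ) : ℝ := (Z - k * (t - a)) ^ (1 / (1 + α))

/-- The time derivative of `shrinkingRadius`. -/
noncomputable def shrinkingRadiusDeriv (α Z k a t : ℝ) : ℝ :=
  -(k / (1 + α)) * shrinkingRadius α Z k a t ^ (-α)

lemma shrinkingRadius_pos (h : 0 < Z - k * (t - a)) : 0 < shrinkingRadius α Z k a t :=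
  Real.rpow_pos_of_pos h _

lemma shrinkingRadius_rpow (hα : 0 < α) (h : 0 ≤ Z - k * (t - a)) :
    shrinkingRadius α Z k a t ^ (1 + α) = Z - k * (t - a) := by
  rw [shrinkingRadius, ← Real.rpow_mul h, one_div_mul_cancel (by positivity), Real.rpow_one]

lemma contDiffOn_shrinkingRadius (h : ∀ t ∈ Icc a b, 0 < Z - k * (t - a)) :
    ContDiffOn ℝ ∞ (shrinkingRadius α Z k a) (Icc a b) := by
  refine ContDiffOn.rpow_const_of_ne ?_ fun t ht => (h t ht).ne'
  fun_prop

lemma hasDerivAt_shrinkingRadius (hα : 0 < α) (h : 0 < Z - k * (t - a)) :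
    HasDerivAt (shrinkingRadius α Z k a) (shrinkingRadiusDeriv α Z k a t) t := by
  have hbase : HasDerivAt (fun t => Z - k * (t - a)) (-k) t := by
    simpa using! (((hasDerivAt_id t).sub_const a).const_mul k).const_sub Z
  have hexp : 1 / (1 + α) - 1 = 1 / (1 + α) * -α := by
    field_simp
    ring
  refine (hbase.rpow_const (p := 1 / (1 + α)) (Or.inl h.ne')).congr_deriv ?_
  rw [shrinkingRadiusDeriv, shrinkingRadius, ← Real.rpow_mul h.le, hexp]
  ring

lemma shrinkingRadius_rpow_mul_deriv (h : 0 < Z - k * (t - a)) :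
    shrinkingRadius α Z k a t ^ α * -shrinkingRadiusDeriv α Z k a t = k / (1 + α) := by
  have hR := shrinkingRadius_pos (α := α) h
  rw [shrinkingRadiusDeriv, Real.rpow_neg hR.le]
  have := (Real.rpow_pos_of_pos hR α).ne'
  field_simp

lemma shrinkingRadius_le (hα : 0 < α) (hk : 0 ≤ k) (hat : a ≤ t) (h : 0 ≤ Z - k * (t - a)) :
    shrinkingRadius α Z k a t ≤ shrinkingRadius α Z k a a := by
  refine Real.rpow_le_rpow h ?_ (by positivity)
  have := mul_nonneg hk (sub_nonneg.mpr hat)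
  rw [sub_self, mul_zero, sub_zero]
  linarith

lemma cylinderRadius_eq {n : ℕ} [NeZero n] (f : (Fin n → ℝ) → ℝ) (α t : ℝ) :
    cylinderRadius f α t = shrinkingRadius α 1 ((1 + α) * fHat f 0 ^ α) 0 t := by
  rw [cylinderRadius, shrinkingRadius, sub_zero]

end ShrinkingRadius

section OuterEstimates

variable {n : ℕ} {α a b : ℝ}

lemma radialSq_add_sq_le_of_axial_le {M h η ρ σ : ℝ} (hη : 0 < η) (hσ : σ ^ 2 = 1)
    (hρ : M + |h| + η ≤ ρ) (hρη : M ^ 2 ≤ ρ * η) {x : AmbientSpace n} (hx : ‖x‖ ≤ M)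
    (hxh : σ * x (Fin.last n) ≤ h) :
    radialSq x + (x (Fin.last n) - σ * (h + η - ρ)) ^ 2 ≤ ρ ^ 2 := by
  set d := h + η - σ * x (Fin.last n)
  have hrewrite : (x (Fin.last n) - σ * (h + η - ρ)) ^ 2 = (ρ - d) ^ 2 := by
    linear_combination (-x (Fin.last n) ^ 2 + (h + η - ρ) ^ 2) * hσ
  have hradial : radialSq x ≤ M ^ 2 :=
    (radialSq_le_norm_sq x).trans (pow_le_pow_left₀ (norm_nonneg _) hx 2)
  have hσabs : |σ| = 1 := (sq_eq_sq₀ (abs_nonneg σ) zero_le_one).mp (by rw [sq_abs, hσ, one_pow])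
  have hσx : |σ * x (Fin.last n)| ≤ M := by
    rw [abs_mul, hσabs, one_mul]
    exact (abs_last_le_norm x).trans hx
  have hdη : η ≤ d := by linarith
  have hdρ : d ≤ ρ := by linarith [(abs_le.mp hσx).1, le_abs_self h]
  rw [hrewrite]
  nlinarith [mul_nonneg (sub_nonneg.mpr hdη) (hη.le.trans (hdη.trans hdρ)),
    mul_nonneg (hη.le.trans hdη) (sub_nonneg.mpr hdρ)]

lemma exists_ellipsoid_superset {ρ M : ℝ} (hρ : 1 < ρ) (hM : 0 < M) :
    ∃ e > 0, e * ρ ^ 2 ≤ 1 ∧ ∀ x : AmbientSpace n, radialSq x ≤ 1 → ‖x‖ ≤ M →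
      radialSq x / ρ ^ 2 + e * x (Fin.last n) ^ 2 ≤ 1 := by
  have hgap : 0 < 1 - (ρ ^ 2)⁻¹ :=
    sub_pos.mpr (inv_lt_one_of_one_lt₀ (one_lt_pow₀ hρ two_ne_zero))
  refine ⟨min (ρ ^ 2)⁻¹ ((1 - (ρ ^ 2)⁻¹) / M ^ 2), by positivity, ?_, fun x hx hxM => ?_⟩
  · rw [← le_div_iff₀ (by positivity), one_div]
    exact min_le_left _ _
  · have hradial : radialSq x / ρ ^ 2 ≤ (ρ ^ 2)⁻¹ := by
      rw [div_eq_mul_inv]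
      exact mul_le_of_le_one_left (by positivity) hx
    have haxial : x (Fin.last n) ^ 2 ≤ M ^ 2 := sq_le_sq.mpr
      (((abs_last_le_norm x).trans hxM).trans (le_abs_self M))
    have hmul := mul_le_mul (min_le_right (ρ ^ 2)⁻¹ ((1 - (ρ ^ 2)⁻¹) / M ^ 2)) haxial
      (sq_nonneg _) (by positivity)
    rw [div_mul_cancel₀ _ (by positivity)] at hmul
    linarith

/-- The ellipsoids of revolution about `(0, y₀)` with `R ^ (1 + α) = Z - k * (t - a)` and
`v = e (y - y₀)²`. -/
noncomputable def ellipsoidFamily {Z k e : ℝ} (hα : 0 < α) (hab : a < b)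
    (hZ : ∀ t ∈ Icc a b, 0 < Z - k * (t - a)) (he : 0 < e) (y₀ : ℝ) : ProfileFamily a b where
  R := shrinkingRadius α Z k a
  R' := shrinkingRadiusDeriv α Z k a
  v _ y := e * (y - y₀) ^ 2
  v₁ _ y := 2 * e * (y - y₀)
  v₂ _ _ := 2 * e
  vₜ _ _ := 0
  lt := hab
  pos t ht := shrinkingRadius_pos (hZ t ht)
  smooth_radius := contDiffOn_shrinkingRadius hZ
  deriv_radius t ht := (hasDerivAt_shrinkingRadius hα (hZ t ht)).hasDerivWithinAt
  smooth := by fun_prop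
  deriv_one t _ y := by
    refine ((((hasDerivAt_id y).sub_const y₀).pow 2).const_mul e).congr_deriv ?_
    simp only [Nat.cast_ofNat, id_eq, Nat.add_one_sub_one, pow_one, mul_one]
    ring
  deriv_two t _ y := by simpa using! ((hasDerivAt_id y).sub_const y₀).const_mul (2 * e)
  deriv_time t _ y := hasDerivWithinAt_const _ _ _
  convex _ _ _ := by positivity
  regular t _ y h h₁ := by
    have : y - y₀ = 0 := by simpa [he.ne'] using h₁
    simp [this] at h

variable [NeZero n] {f : (Fin n → ℝ) → ℝ}

-- The axial curvature only helps, so it suffices that `1 - v ≤ N ≤ N ^ ((1 - α) / 2)`.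
lemma IsSpeedFunction.isSmoothSupersolution_ellipsoid (hf : IsSpeedFunction f) (hα : 0 < α)
    {Z k e y₀ : ℝ} (hab : a < b) (hk : 0 ≤ k) (hkF : k ≤ (1 + α) * fHat f 0 ^ α)
    (hZ : ∀ t ∈ Icc a b, 0 < Z - k * (t - a)) (he : 0 < e)
    (heR : e * shrinkingRadius α Z k a a ^ 2 ≤ 1) :
    IsSmoothSupersolution f α a b fun t =>
      solidOfRevolution n (shrinkingRadius α Z k a t) fun y => e * (y - y₀) ^ 2 := by
  let H := ellipsoidFamily hα hab hZ he y₀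
  refine H.isSmoothSupersolution hf fun t ht y hy => ?_
  set R := shrinkingRadius α Z k a t
  have hRpos : 0 < R := H.pos t ht
  have hN := H.normalSq_pos ht hy
  have hNv : H.normalSq t y = 1 - e * (y - y₀) ^ 2 + (e * R ^ 2) * (e * (y - y₀) ^ 2) := by
    simp only [ProfileFamily.normalSq, normalSq, H, ellipsoidFamily]
    ring
  have heR' : e * R ^ 2 ≤ 1 :=
    (mul_le_mul_of_nonneg_left (pow_le_pow_left₀ hRpos.le
      (shrinkingRadius_le hα hk ht.1 (hZ t ht).le) 2) he.le).trans heR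
  have hN_le : H.normalSq t y ≤ 1 := by
    have := mul_le_mul_of_nonneg_right heR' (by positivity : 0 ≤ e * (y - y₀) ^ 2)
    linarith
  have hN_ge : 1 - e * (y - y₀) ^ 2 ≤ H.normalSq t y :=
    hNv ▸ le_add_of_nonneg_right (by positivity)
  have hpow : H.normalSq t y ≤ H.normalSq t y ^ ((1 - α) / 2) := by
    conv_lhs => rw [← Real.rpow_one (H.normalSq t y)]
    exact Real.rpow_le_rpow_of_exponent_ge hN hN_le (by linarith)
  have hF := hf.fHat_zero_nonneg
  calc H.rescaledVelocity α t y
      = k / (1 + α) * (1 - e * (y - y₀) ^ 2) := by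
        rw [← shrinkingRadius_rpow_mul_deriv (hZ t ht)]
        simp only [ProfileFamily.rescaledVelocity, H, ellipsoidFamily]
        ring
    _ ≤ fHat f 0 ^ α * H.normalSq t y ^ ((1 - α) / 2) :=
        mul_le_mul (by rwa [div_le_iff₀' (by positivity)]) (hN_ge.trans hpow)
          (sub_nonneg.mpr hy) (Real.rpow_nonneg hF α)
    _ ≤ H.rescaledSpeed f α t y := by
        rw [mul_comm, ProfileFamily.rescaledSpeed]
        gcongr
        exact hf.fHat_mono le_rfl (H.curvatureRatio_pos ht hy).le

variable {T : ℝ} {Ω : ℝ → Set (AmbientSpace n)}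

lemma subset_ball_of_isInnerBarrier (hf : IsSpeedFunction f) (hα : 0 < α)
    (hΩ : IsInnerBarrier f α (Ico 0 T) Ω) {s t ρ y₀ : ℝ} (hs : 0 ≤ s) (hst : s ≤ t) (htT : t < T)
    (hρ : 0 < ρ) (h : ∀ x ∈ Ω s, radialSq x + (x (Fin.last n) - y₀) ^ 2 ≤ ρ ^ 2) :
    ∀ x ∈ Ω t, radialSq x + (x (Fin.last n) - y₀) ^ 2 ≤ ρ ^ 2 := by
  rcases hst.eq_or_lt with rfl | hst
  · exact h
  have hF : 0 ≤ fHat f 0 := hf.fHat_zero_nonneg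
  have hradius (u : ℝ) : shrinkingRadius α (ρ ^ (1 + α)) 0 s u = ρ := by
    rw [shrinkingRadius, zero_mul, sub_zero, ← Real.rpow_mul hρ.le,
      mul_one_div_cancel (by positivity), Real.rpow_one]
  have hsup := hf.isSmoothSupersolution_ellipsoid hα (Z := ρ ^ (1 + α)) (e := (ρ ^ 2)⁻¹)
    (y₀ := y₀) hst le_rfl (by positivity)
    (fun u _ => by simpa using Real.rpow_pos_of_pos hρ _) (by positivity)
    (by rw [hradius, inv_mul_cancel₀ (by positivity)])
  have hmem (u : ℝ) (x : AmbientSpace n) :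
      x ∈ solidOfRevolution n (shrinkingRadius α (ρ ^ (1 + α)) 0 s u)
        (fun y => (ρ ^ 2)⁻¹ * (y - y₀) ^ 2) ↔
      radialSq x + (x (Fin.last n) - y₀) ^ 2 ≤ ρ ^ 2 := by
    rw [solidOfRevolution, mem_ofPred_eq, hradius, inv_mul_eq_div, ← add_div,
      div_le_one (by positivity)]
  intro x hx
  exact (hmem t x).mp (hΩ s t _ hst (fun u hu => ⟨hs.trans hu.1, hu.2.trans_lt htT⟩) hsup
    (fun x hx => (hmem s x).mpr (h x hx)) t ⟨hst.le, le_rfl⟩ hx)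

lemma isBounded_of_isInnerBarrier (hf : IsSpeedFunction f) (hα : 0 < α)
    (hΩ : IsInnerBarrier f α (Ico 0 T) Ω) (hb : Bornology.IsBounded (Ω 0)) {t : ℝ}
    (ht : t ∈ Ico 0 T) : Bornology.IsBounded (Ω t) := by
  obtain ⟨M, hM, hle⟩ := hb.exists_pos_norm_le
  have hball := subset_ball_of_isInnerBarrier hf hα hΩ (y₀ := 0) le_rfl ht.1 ht.2 hM
  simp only [sub_zero, ← norm_sq_eq_radialSq_add] at hball
  exact isBounded_iff_forall_norm_le.mpr ⟨M, fun x hx =>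
    le_of_sq_le_sq (hball (fun x hx => pow_le_pow_left₀ (norm_nonneg _) (hle x hx) 2) x hx) hM.le⟩

-- The half-space is exhausted by large balls centred on the axis.
lemma axial_le_of_isInnerBarrier (hf : IsSpeedFunction f) (hα : 0 < α)
    (hΩ : IsInnerBarrier f α (Ico 0 T) Ω) {s t h σ : ℝ} (hs : 0 ≤ s) (hst : s ≤ t) (htT : t < T)
    (hb : Bornology.IsBounded (Ω s)) (hσ : σ ^ 2 = 1)
    (hh : ∀ x ∈ Ω s, σ * x (Fin.last n) ≤ h) : ∀ x ∈ Ω t, σ * x (Fin.last n) ≤ h := by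
  obtain ⟨M, hM, hMx⟩ := hb.exists_pos_norm_le
  intro x hx
  refine le_of_forall_pos_le_add fun η hη => ?_
  obtain ⟨ρ, hρ, hρη⟩ : ∃ ρ, M + |h| + η ≤ ρ ∧ M ^ 2 ≤ ρ * η :=
    ⟨max (M + |h| + η) (M ^ 2 / η), le_max_left _ _, (div_le_iff₀ hη).mp (le_max_right _ _)⟩
  have hρpos : 0 < ρ := by linarith [abs_nonneg h]
  have hball := subset_ball_of_isInnerBarrier hf hα hΩ (y₀ := σ * (h + η - ρ)) hs hst htT hρpos
    (fun z hz => radialSq_add_sq_le_of_axial_le hη hσ hρ hρη (hMx z hz) (hh z hz)) x hx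
  have hsq : (σ * x (Fin.last n) - (h + η - ρ)) ^ 2 ≤ ρ ^ 2 := by
    linear_combination hball + radialSq_nonneg x + (x (Fin.last n) ^ 2 - (h + η - ρ) ^ 2) * hσ
  linarith [(abs_le.mp (abs_le_of_sq_le_sq hsq hρpos.le)).2]

lemma radialSq_le_of_one_lt (hf : IsSpeedFunction f) (hα : 0 < α)
    (hΩ : IsInnerBarrier f α (Ico 0 T) Ω) (hb : Bornology.IsBounded (Ω 0))
    (h0 : Ω 0 ⊆ closedCylinder n 1) {t Z : ℝ} (ht0 : 0 < t) (htT : t < T)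
    (htk : (1 + α) * fHat f 0 ^ α * t ≤ 1) (hZ : 1 < Z) {x : AmbientSpace n} (hx : x ∈ Ω t) :
    radialSq x ≤ shrinkingRadius α Z ((1 + α) * fHat f 0 ^ α) 0 t ^ 2 := by
  have hF := hf.fHat_zero_nonneg
  set k := (1 + α) * fHat f 0 ^ α
  have hk0 : 0 ≤ k := by positivity
  have hpos (u : ℝ) (hu : u ∈ Icc 0 t) : 0 < Z - k * (u - 0) := by
    linarith [mul_le_mul_of_nonneg_left hu.2 hk0]
  have hρ : 1 < shrinkingRadius α Z k 0 0 := by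
    simpa [shrinkingRadius] using Real.one_lt_rpow hZ (by positivity : 0 < 1 / (1 + α))
  obtain ⟨M, hM, hMx⟩ := hb.exists_pos_norm_le
  obtain ⟨e, he, heρ, hsub⟩ := exists_ellipsoid_superset (n := n) hρ hM
  have hsup := hf.isSmoothSupersolution_ellipsoid hα (y₀ := 0) ht0 hk0 le_rfl hpos he heρ
  simp only [sub_zero] at hsup
  have hxt : radialSq x / shrinkingRadius α Z k 0 t ^ 2 + e * x (Fin.last n) ^ 2 ≤ 1 :=
    hΩ 0 t _ ht0 (fun u hu => ⟨hu.1, hu.2.trans_lt htT⟩) hsup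
      (fun z hz => hsub z ((h0 hz).trans_eq (one_pow 2)) (hMx z hz)) t ⟨ht0.le, le_rfl⟩ hx
  have hR : 0 < shrinkingRadius α Z k 0 t := shrinkingRadius_pos (hpos t ⟨ht0.le, le_rfl⟩)
  rw [← div_le_one (by positivity)]
  exact (le_add_of_nonneg_right (by positivity)).trans hxt

lemma subset_closedCylinder (hf : IsSpeedFunction f) (hα : 0 < α)
    (hΩ : IsInnerBarrier f α (Ico 0 T) Ω) (hb : Bornology.IsBounded (Ω 0))
    (h0 : Ω 0 ⊆ closedCylinder n 1) {t : ℝ} (ht : t ∈ Ico 0 T)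
    (htk : (1 + α) * fHat f 0 ^ α * t ≤ 1) :
    Ω t ⊆ closedCylinder n (cylinderRadius f α t) := by
  rcases ht.1.eq_or_lt with rfl | ht0
  · simpa [cylinderRadius] using h0
  intro x hx
  rw [cylinderRadius_eq]
  have hcont : Continuous fun Z : ℝ =>
      shrinkingRadius α Z ((1 + α) * fHat f 0 ^ α) 0 t ^ 2 := by
    unfold shrinkingRadius
    exact ((continuous_id.sub continuous_const).rpow_const fun _ => Or.inr (by positivity)).pow 2
  refine ge_of_tendsto ((hcont.tendsto 1).mono_left (nhdsWithin_le_nhds (s := Ioi 1))) ?_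
  filter_upwards [self_mem_nhdsWithin] with Z hZ
  exact radialSq_le_of_one_lt hf hα hΩ hb h0 ht0 ht.2 htk hZ hx

end OuterEstimates

section CapProfiles

/-- A strictly convex profile `V` with first and second derivatives `p` and `p'` which is flat to
the left and reaches the value `1` before `s = 7 / 8`; the parameter `ε` measures how flat it is.
Such a profile closes up one end of a thin solid of revolution. -/
structure CapProfile (ε : ℝ) where
  param_pos : 0 < ε
  param_le : ε ≤ 1 / 8
  V : ℝ → ℝ
  p : ℝ → ℝ
  p' : ℝ → ℝ
  smooth : ContDiff ℝ ∞ V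
  hasDerivAt : ∀ s, HasDerivAt V (p s) s
  hasDerivAt_deriv : ∀ s, HasDerivAt p (p' s) s
  pos : ∀ s, 0 < V s
  deriv_pos : ∀ s, 0 < p s
  deriv_deriv_pos : ∀ s, 0 < p' s
  le_deriv : ∀ s, V s ≤ p s
  deriv_deriv_le : ∀ s, p' s ≤ 8 * (1 + p s)
  deriv_le_of_le_one : ∀ s, V s ≤ 1 → p s ≤ 17
  le_of_le_one : ∀ s, V s ≤ 1 → s ≤ 7 / 8
  deriv_le_exp : ∀ s, s ≤ -(1 / 2) → p s ≤ Real.exp (-(1 / (2 * ε)))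

lemma CapProfile.deriv_le_eighth {ε : ℝ} (c : CapProfile ε) {s : ℝ} (hs : s ≤ -(1 / 2)) :
    c.p s ≤ 1 / 8 := by
  have hε := c.param_pos
  have hε' := c.param_le
  have hexp : 8 ≤ Real.exp (1 / (2 * ε)) := calc
    (8 : ℝ) ≤ 2 ^ 4 := by norm_num
    _ ≤ Real.exp 1 ^ 4 := by
      gcongr
      exact Real.exp_one_gt_two.le
    _ = Real.exp 4 := by rw [← Real.exp_nat_mul]; norm_num
    _ ≤ Real.exp (1 / (2 * ε)) := by
      gcongr
      rw [le_div_iff₀ (by positivity)]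
      linarith
  refine (c.deriv_le_exp s hs).trans ?_
  rw [Real.exp_neg, inv_eq_one_div]
  exact one_div_le_one_div_of_le (by norm_num) hexp

/-- Weights `μ` on the logarithm of the slope that prescribe an upper bound for the second
derivative of a cap profile: there is a cap profile with `p' ≤ 1 / μ (log p)`. -/
structure IsCapDensity (μ : ℝ → ℝ) : Prop where
  smooth : ContDiff ℝ ∞ μ
  nonneg : ∀ q, 0 ≤ μ q
  intervalIntegrable : ∀ z, 0 < z → IntervalIntegrable (fun z => μ (Real.log z)) volume 0 z
  integral_le : ∀ z, 0 < z → ∫ u in (0 : ℝ)..z, μ (Real.log u) ≤ 1 / 8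
  mul_le : ∀ z, 0 < z → z * μ (Real.log z) ≤ 1 / 2

variable {ε : ℝ} {μ : ℝ → ℝ}

/-- The derivative `ds/dq` of the position `s` on a cap profile with respect to the logarithm `q`
of its slope. -/
noncomputable def capPositionDeriv (ε : ℝ) (μ : ℝ → ℝ) (q : ℝ) : ℝ :=
  ε + 1 / 8 * (Real.exp q / (1 + Real.exp q)) + Real.exp q * μ q

/-- The position on a cap profile at which the logarithm of the slope is `q`. -/
noncomputable def capPosition (ε : ℝ) (μ : ℝ → ℝ) (q : ℝ) : ℝ :=
  ε * q + 1 / 8 * Real.log (1 + Real.exp q) + ∫ u in (0 : ℝ)..Real.exp q, μ (Real.log u)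

/-- The height of a cap profile at the point where its slope is `z`. -/
noncomputable def capHeight (ε : ℝ) (μ : ℝ → ℝ) (z : ℝ) : ℝ :=
  ε * z + 1 / 8 * (z - Real.log (1 + z)) + ∫ u in (0 : ℝ)..z, u * μ (Real.log u)

lemma contDiff_capPositionDeriv (hμ : ContDiff ℝ ∞ μ) :
    ContDiff ℝ ∞ (capPositionDeriv ε μ) := by
  have hexp := Real.contDiff_exp (n := ∞)
  exact (contDiff_const.add (contDiff_const.mul
    (hexp.div (contDiff_const.add hexp) fun q => by positivity))).add (hexp.mul hμ)

lemma capPositionDeriv_pos (hε : 0 < ε) (hμ : ∀ q, 0 ≤ μ q) (q : ℝ) :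
    0 < capPositionDeriv ε μ q := by
  have := hμ q
  rw [capPositionDeriv]
  positivity

lemma log_one_add_exp_nonneg (q : ℝ) : 0 ≤ Real.log (1 + Real.exp q) :=
  Real.log_nonneg (le_add_of_nonneg_right (Real.exp_pos q).le)

lemma log_one_add_le {z : ℝ} (hz : 0 < z) : Real.log (1 + z) ≤ z :=
  (Real.log_le_sub_one_of_pos (by positivity)).trans_eq (add_sub_cancel_left 1 z)

namespace IsCapDensity

variable (hμ : IsCapDensity μ)

include hμ

lemma measurable_comp_log : Measurable fun z => μ (Real.log z) :=
  hμ.smooth.continuous.measurable.comp Real.measurable_log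

lemma continuousAt_comp_log (q : ℝ) : ContinuousAt (fun z => μ (Real.log z)) (Real.exp q) :=
  hμ.smooth.continuous.continuousAt.comp (Real.continuousAt_log (Real.exp_pos q).ne')

lemma hasDerivAt_capPosition (q : ℝ) :
    HasDerivAt (capPosition ε μ) (capPositionDeriv ε μ q) q := by
  have hintegral : HasDerivAt (fun z => ∫ u in (0 : ℝ)..z, μ (Real.log u))
      (μ (Real.log (Real.exp q))) (Real.exp q) :=
    intervalIntegral.integral_hasDerivAt_right (hμ.intervalIntegrable _ (Real.exp_pos q))
      hμ.measurable_comp_log.stronglyMeasurable.stronglyMeasurableAtFilter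
      (hμ.continuousAt_comp_log q)
  have hlog : HasDerivAt (fun q => Real.log (1 + Real.exp q)) _ q :=
    ((Real.hasDerivAt_exp q).const_add 1).log (by positivity)
  refine ((((hasDerivAt_id q).const_mul ε).add (hlog.const_mul (1 / 8))).add
    (hintegral.comp q (Real.hasDerivAt_exp q))).congr_deriv ?_
  rw [capPositionDeriv, Real.log_exp]
  ring

lemma contDiff_capPosition : ContDiff ℝ ∞ (capPosition ε μ) := by
  rw [contDiff_infty_iff_deriv, deriv_eq fun q => hμ.hasDerivAt_capPosition q]
  exact ⟨fun q => (hμ.hasDerivAt_capPosition q).differentiableAt,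
    contDiff_capPositionDeriv hμ.smooth⟩

lemma le_capPosition (q : ℝ) :
    ε * q + 1 / 8 * Real.log (1 + Real.exp q) ≤ capPosition ε μ q :=
  le_add_of_nonneg_right
    (intervalIntegral.integral_nonneg (Real.exp_pos q).le fun _ _ => hμ.nonneg _)

lemma capPosition_le (q : ℝ) :
    capPosition ε μ q ≤ ε * q + 1 / 8 * Real.log (1 + Real.exp q) + 1 / 8 := by
  rw [capPosition]
  gcongr
  exact hμ.integral_le _ (Real.exp_pos q)

lemma surjective_capPosition (hε : 0 < ε) : Function.Surjective (capPosition ε μ) := by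
  refine (hμ.contDiff_capPosition (ε := ε)).continuous.surjective ?_ ?_
  · refine tendsto_atTop_mono (fun q => ?_) (tendsto_id.const_mul_atTop hε)
    exact (le_add_of_nonneg_right (mul_nonneg (by norm_num) (log_one_add_exp_nonneg q))).trans
      (hμ.le_capPosition q)
  · have hlin : Tendsto (fun q => ε * q + 1 / 4) atBot atBot :=
      tendsto_atBot_add_const_right _ _ (tendsto_id.const_mul_atBot hε)
    refine tendsto_atBot_mono' _ ?_ hlin
    filter_upwards [eventually_le_atBot 0] with q hq
    linarith [hμ.capPosition_le (ε := ε) q, log_one_add_le (Real.exp_pos q),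
      Real.exp_le_one_iff.mpr hq]

lemma exists_capPosition_inverse (hε : 0 < ε) :
    ∃ Q : ℝ → ℝ, ContDiff ℝ ∞ Q ∧ (∀ s, capPosition ε μ (Q s) = s) ∧
      ∀ s, HasDerivAt Q (capPositionDeriv ε μ (Q s))⁻¹ s := by
  have hpos := capPositionDeriv_pos hε hμ.nonneg
  have hmono : StrictMono (capPosition ε μ) := strictMono_of_deriv_pos fun q =>
    (hμ.hasDerivAt_capPosition q).deriv ▸ hpos q
  let e : ℝ ≃ₜ ℝ :=
    (hmono.orderIsoOfSurjective _ (hμ.surjective_capPosition hε)).toHomeomorph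
  refine ⟨e.symm, e.contDiff_symm_deriv (fun q => (hpos q).ne') hμ.hasDerivAt_capPosition
    hμ.contDiff_capPosition, e.apply_symm_apply, fun s => ?_⟩
  exact (hμ.hasDerivAt_capPosition _).of_local_left_inverse e.symm.continuous.continuousAt
    (hpos _).ne' (Eventually.of_forall e.apply_symm_apply)

lemma intervalIntegrable_mul {z : ℝ} (hz : 0 < z) :
    IntervalIntegrable (fun u => u * μ (Real.log u)) volume 0 z :=
  (hμ.intervalIntegrable z hz).continuousOn_mul continuousOn_id

lemma hasDerivAt_capHeight (q : ℝ) :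
    HasDerivAt (capHeight ε μ) (capPositionDeriv ε μ q) (Real.exp q) := by
  have hq := Real.exp_pos q
  have hintegral : HasDerivAt (fun z => ∫ u in (0 : ℝ)..z, u * μ (Real.log u))
      (Real.exp q * μ (Real.log (Real.exp q))) (Real.exp q) :=
    intervalIntegral.integral_hasDerivAt_right (hμ.intervalIntegrable_mul hq)
      (measurable_id.mul hμ.measurable_comp_log).stronglyMeasurable.stronglyMeasurableAtFilter
      (continuousAt_id.mul (hμ.continuousAt_comp_log q))
  have hlog : HasDerivAt (fun z => Real.log (1 + z)) _ (Real.exp q) :=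
    ((hasDerivAt_id (Real.exp q)).const_add 1).log (by simp only [id]; positivity)
  refine ((((hasDerivAt_id _).const_mul ε).add
    (((hasDerivAt_id _).sub hlog).const_mul (1 / 8))).add hintegral).congr_deriv ?_
  rw [capPositionDeriv, Real.log_exp, id]
  field_simp
  ring

lemma integral_mul_nonneg {z : ℝ} (hz : 0 < z) : 0 ≤ ∫ u in (0 : ℝ)..z, u * μ (Real.log u) :=
  intervalIntegral.integral_nonneg hz.le fun _ hu => mul_nonneg hu.1 (hμ.nonneg _)

lemma integral_mul_le {z : ℝ} (hz : 0 < z) : ∫ u in (0 : ℝ)..z, u * μ (Real.log u) ≤ z / 2 :=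
  calc ∫ u in (0 : ℝ)..z, u * μ (Real.log u)
      ≤ ∫ _ in (0 : ℝ)..z, (1 / 2 : ℝ) :=
        intervalIntegral.integral_mono_on_of_le_Ioo hz.le (hμ.intervalIntegrable_mul hz)
          intervalIntegrable_const fun u hu => hμ.mul_le u hu.1
    _ = z / 2 := by
        rw [intervalIntegral.integral_const, sub_zero, smul_eq_mul, mul_one_div]

lemma capHeight_pos (hε : 0 < ε) {z : ℝ} (hz : 0 < z) : 0 < capHeight ε μ z := by
  have := sub_nonneg.mpr (log_one_add_le hz)
  have := hμ.integral_mul_nonneg hz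
  rw [capHeight]
  positivity

lemma capHeight_le (hε' : ε ≤ 1 / 8) {z : ℝ} (hz : 0 < z) : capHeight ε μ z ≤ z := by
  have hlog : 0 ≤ Real.log (1 + z) := Real.log_nonneg (le_add_of_nonneg_right hz.le)
  rw [capHeight]
  linarith [hμ.integral_mul_le hz, mul_le_mul_of_nonneg_right hε' hz.le]

lemma le_of_capHeight_le_one (hε : 0 < ε) {z : ℝ} (hz : 0 < z) (h : capHeight ε μ z ≤ 1) :
    z ≤ 17 := by
  have hlog : Real.log (1 + z) ≤ (1 + z) / 2 := by
    have hhalf := Real.log_le_sub_one_of_pos (show 0 < (1 + z) / 2 by positivity)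
    rw [Real.log_div (by positivity) two_ne_zero] at hhalf
    linarith [Real.log_two_lt_d9]
  rw [capHeight] at h
  linarith [hμ.integral_mul_nonneg hz, mul_pos hε hz]

lemma capPosition_le_of_exp_le (hε : 0 < ε) (hε' : ε ≤ 1 / 8) {q : ℝ} (hq : Real.exp q ≤ 17) :
    capPosition ε μ q ≤ 7 / 8 := by
  have hexp : 18 ≤ Real.exp 3 := calc
    (18 : ℝ) ≤ 2.7 ^ 3 := by norm_num
    _ ≤ Real.exp 1 ^ 3 := by
      gcongr
      linarith [Real.exp_one_gt_d9]
    _ = Real.exp 3 := by rw [← Real.exp_nat_mul]; norm_num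
  have hlog : Real.log (1 + Real.exp q) ≤ 3 := by
    rw [Real.log_le_iff_le_exp (by positivity)]
    linarith
  have hq3 : q ≤ 3 := Real.exp_le_exp.mp (by linarith)
  linarith [hμ.capPosition_le (ε := ε) q, mul_le_mul_of_nonneg_left hq3 hε.le]

-- Parametrizing the cap by the logarithm `q` of its slope, `ds/dq = S q` and `p' = p / S (log p)`.
-- The three summands of `S` give the flatness to the left, the bound on `p'` and the bound by `μ`.
lemma exists_capProfile (hε : 0 < ε) (hε' : ε ≤ 1 / 8) :
    ∃ c : CapProfile ε, ∀ s, c.p' s * μ (Real.log (c.p s)) ≤ 1 := by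
  obtain ⟨Q, hQ, hposition, hderiv⟩ := hμ.exists_capPosition_inverse hε
  have hS := capPositionDeriv_pos hε hμ.nonneg
  have hpos (s : ℝ) : 0 < Real.exp (Q s) := Real.exp_pos _
  have hV (s : ℝ) : HasDerivAt (fun s => capHeight ε μ (Real.exp (Q s))) (Real.exp (Q s)) s := by
    refine ((hμ.hasDerivAt_capHeight (Q s)).comp s (hderiv s).exp).congr_deriv ?_
    rw [mul_comm, mul_assoc, inv_mul_cancel₀ (hS _).ne', mul_one]
  have hslope {s : ℝ} (h : capHeight ε μ (Real.exp (Q s)) ≤ 1) : Real.exp (Q s) ≤ 17 :=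
    hμ.le_of_capHeight_le_one hε (hpos s) h
  refine ⟨{ param_pos := hε
            param_le := hε'
            V := fun s => capHeight ε μ (Real.exp (Q s))
            p := fun s => Real.exp (Q s)
            p' := fun s => Real.exp (Q s) * (capPositionDeriv ε μ (Q s))⁻¹
            smooth := ?_
            hasDerivAt := hV
            hasDerivAt_deriv := fun s => (hderiv s).exp
            pos := fun s => hμ.capHeight_pos hε (hpos s)
            deriv_pos := hpos
            deriv_deriv_pos := fun s => mul_pos (hpos s) (inv_pos.mpr (hS _))
            le_deriv := fun s => hμ.capHeight_le hε' (hpos s)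
            deriv_deriv_le := fun s => ?_
            deriv_le_of_le_one := fun s => hslope
            le_of_le_one := fun s hs =>
              (hposition s).symm.le.trans (hμ.capPosition_le_of_exp_le hε hε' (hslope hs))
            deriv_le_exp := fun s hs => ?_ }, fun s => ?_⟩
  · rw [contDiff_infty_iff_deriv, deriv_eq hV]
    exact ⟨fun s => (hV s).differentiableAt, hQ.exp⟩
  · rw [← div_eq_mul_inv, div_le_iff₀ (hS _)]
    have := hμ.nonneg (Q s)
    calc Real.exp (Q s)
        = 8 * (1 + Real.exp (Q s)) * (1 / 8 * (Real.exp (Q s) / (1 + Real.exp (Q s)))) := by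
          field_simp
      _ ≤ 8 * (1 + Real.exp (Q s)) * capPositionDeriv ε μ (Q s) := by
          rw [capPositionDeriv]
          gcongr
          linarith [mul_nonneg (hpos s).le this]
  · have hle := hμ.le_capPosition (ε := ε) (Q s)
    rw [hposition] at hle
    refine Real.exp_le_exp.mpr ?_
    rw [← div_div, ← neg_div, le_div_iff₀' hε]
    linarith [log_one_add_exp_nonneg (Q s)]
  · rw [Real.log_exp, mul_right_comm, ← div_eq_mul_inv, div_le_one (hS _), capPositionDeriv]
    exact le_add_of_nonneg_left (by positivity)

end IsCapDensity

lemma exp_two_le_eight : Real.exp 2 ≤ 8 := calc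
  Real.exp 2 = Real.exp 1 ^ 2 := by rw [← Real.exp_nat_mul]; norm_num
  _ ≤ 2.8 ^ 2 := by
    gcongr
    linarith [Real.exp_one_lt_d9]
  _ ≤ 8 := by norm_num

lemma exists_contDiff_mem_Icc_of_antitoneOn {η : ℝ → ℝ} (hη : AntitoneOn η (Ioi 0)) :
    ∃ μ : ℝ → ℝ, ContDiff ℝ ∞ μ ∧
      ∀ q, μ q ∈ Icc (η (Real.exp q)) (η (Real.exp (q - 2))) := by
  have hanti : Antitone fun q => η (Real.exp q) := fun q q' h =>
    hη (Real.exp_pos _) (Real.exp_pos _) (Real.exp_le_exp.mpr h)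
  obtain ⟨g, hg⟩ := exists_contMDiffMap_forall_mem_convex_of_local_const (n := (⊤ : ℕ∞))
    (modelWithCornersSelf ℝ ℝ)
    (t := fun q : ℝ => Icc (η (Real.exp q)) (η (Real.exp (q - 2)))) (fun q => convex_Icc _ _)
    (fun q => ⟨η (Real.exp (q - 1)), by
      filter_upwards [Ioo_mem_nhds (sub_one_lt q) (lt_add_one q)] with q' hq'
      exact ⟨hanti hq'.1.le, hanti (by linarith [hq'.2])⟩⟩)
  exact ⟨g, contMDiff_iff_contDiff.mp g.contMDiff, hg⟩

section AntitoneDensity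

variable {η : ℝ → ℝ} (hη₀ : ∀ z, 0 ≤ η z) (hanti : AntitoneOn η (Ioi 0)) (hinteg : Integrable η)

include hη₀ hinteg in
lemma intervalIntegral_le_integral {a b : ℝ} (hab : a ≤ b) : ∫ z in a..b, η z ≤ ∫ z, η z := by
  rw [intervalIntegral.integral_of_le hab]
  exact setIntegral_le_integral hinteg (Eventually.of_forall hη₀)

include hη₀ hanti hinteg in
lemma mul_le_two_mul_integral {z : ℝ} (hz : 0 < z) : z * η z ≤ 2 * ∫ u, η u := by
  have hconst : ∫ _ in (z / 2)..z, η z ≤ ∫ u in (z / 2)..z, η u :=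
    intervalIntegral.integral_mono_on (by linarith) intervalIntegrable_const
      hinteg.intervalIntegrable fun u hu => hanti ((half_pos hz).trans_le hu.1) hz hu.2
  rw [intervalIntegral.integral_const, smul_eq_mul] at hconst
  linarith [intervalIntegral_le_integral hη₀ hinteg (by linarith : z / 2 ≤ z)]

include hη₀ hanti hinteg in
lemma exists_isCapDensity (hle : ∫ z, η z ≤ 1 / 64) :
    ∃ μ : ℝ → ℝ, IsCapDensity μ ∧ ∀ z, 0 < z → η z ≤ μ (Real.log z) := by
  obtain ⟨μ, hμ, hmem⟩ := exists_contDiff_mem_Icc_of_antitoneOn hanti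
  have hμ₀ (q : ℝ) : 0 ≤ μ q := (hη₀ _).trans (hmem q).1
  have hμle {z : ℝ} (hz : 0 < z) : μ (Real.log z) ≤ η (Real.exp (-2) * z) := by
    simpa only [sub_eq_neg_add, Real.exp_add, Real.exp_log hz] using (hmem (Real.log z)).2
  have hcomp : Integrable fun z => η (Real.exp (-2) * z) :=
    hinteg.comp_mul_left' (Real.exp_pos _).ne'
  have hinterval (z : ℝ) (hz : 0 < z) :
      IntervalIntegrable (fun z => μ (Real.log z)) volume 0 z := by
    rw [intervalIntegrable_iff_integrableOn_Ioc_of_le hz.le]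
    refine hcomp.integrableOn.mono'
      (hμ.continuous.measurable.comp Real.measurable_log).aestronglyMeasurable
      ((ae_restrict_iff' measurableSet_Ioc).mpr (Eventually.of_forall fun u hu => ?_))
    rw [Real.norm_of_nonneg (hμ₀ _)]
    exact hμle hu.1
  refine ⟨μ, ⟨hμ, hμ₀, hinterval, fun z hz => ?_, fun z hz => ?_⟩, fun z hz => ?_⟩
  · calc ∫ u in (0 : ℝ)..z, μ (Real.log u)
        ≤ ∫ u in (0 : ℝ)..z, η (Real.exp (-2) * u) :=
          intervalIntegral.integral_mono_on_of_le_Ioo hz.le (hinterval z hz)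
            hcomp.intervalIntegrable fun u hu => hμle hu.1
      _ = Real.exp 2 * ∫ u in (0 : ℝ)..Real.exp (-2) * z, η u := by
          rw [intervalIntegral.integral_comp_mul_left η (Real.exp_pos _).ne', mul_zero,
            smul_eq_mul, Real.exp_neg, inv_inv]
      _ ≤ 8 * (1 / 64) := mul_le_mul exp_two_le_eight
          ((intervalIntegral_le_integral hη₀ hinteg (by positivity)).trans hle)
          (intervalIntegral.integral_nonneg (by positivity) fun _ _ => hη₀ _) (by norm_num)
      _ = 1 / 8 := by norm_num
  · calc z * μ (Real.log z)
        ≤ z * η (Real.exp (-2) * z) := mul_le_mul_of_nonneg_left (hμle hz) hz.le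
      _ = Real.exp 2 * (Real.exp (-2) * z * η (Real.exp (-2) * z)) := by
          rw [← mul_assoc, ← mul_assoc, ← Real.exp_add, add_neg_cancel, Real.exp_zero, one_mul]
      _ ≤ 8 * (2 * (1 / 64)) := mul_le_mul exp_two_le_eight
          ((mul_le_two_mul_integral hη₀ hanti hinteg (by positivity)).trans (by linarith))
          (mul_nonneg (by positivity) (hη₀ _)) (by norm_num)
      _ ≤ 1 / 2 := by norm_num
  · simpa only [Real.exp_log hz] using (hmem (Real.log z)).1

end AntitoneDensity

end CapProfiles

section GInv

variable {k : ℝ → ℝ≥0∞}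

lemma exists_lintegral_Ioo_lt (hfin : ∫⁻ z in Ioo (0 : ℝ) 1, k z < ⊤) {δ : ℝ≥0∞} (hδ : 0 < δ) :
    ∃ z₁ > 0, ∫⁻ z in Ioo 0 z₁, k z < δ := by
  obtain ⟨d, hd, hlt⟩ := exists_pos_setLIntegral_lt_of_measure_lt hfin.ne hδ.ne'
  have htendsto : Tendsto ENNReal.ofReal (𝓝[>] 0) (𝓝 0) := by
    simpa using (ENNReal.continuous_ofReal.tendsto 0).mono_left
      (nhdsWithin_le_nhds (s := Ioi (0 : ℝ)))
  obtain ⟨z₁, hz₁d, hz₁⟩ :=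
    ((htendsto.eventually (gt_mem_nhds hd)).and (Ioo_mem_nhdsGT one_pos)).exists
  refine ⟨z₁, hz₁.1, ?_⟩
  simpa [Measure.restrict_restrict measurableSet_Ioo,
    inter_eq_left.mpr (Ioo_subset_Ioo_right hz₁.2.le)] using
    hlt (Ioo 0 z₁) ((Measure.restrict_apply_le _ _).trans_lt (by simpa using hz₁d))

variable (hk : Antitone k)

include hk

lemma ne_top_of_antitone_of_lintegral_ne_top {z₁ : ℝ} (hne : ∫⁻ z in Ioo 0 z₁, k z ≠ ⊤) {z : ℝ}
    (hz : z ∈ Ioo 0 z₁) : k z ≠ ⊤ := by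
  intro htop
  refine hne (top_le_iff.mp ?_)
  calc ⊤ = ∫⁻ _ in Ioo 0 z, (⊤ : ℝ≥0∞) := by
        rw [setLIntegral_const, Real.volume_Ioo, sub_zero, ENNReal.top_mul (by simpa using hz.1)]
    _ ≤ ∫⁻ u in Ioo 0 z, k u := setLIntegral_mono hk.measurable fun u hu => htop ▸ hk hu.2.le
    _ ≤ ∫⁻ u in Ioo 0 z₁, k u := lintegral_mono_set (Ioo_subset_Ioo_right hz.2.le)

lemma exists_integrable_antitoneOn_eq (hfin : ∫⁻ z in Ioo (0 : ℝ) 1, k z < ⊤) {δ : ℝ}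
    (hδ : 0 < δ) :
    ∃ (z₁ : ℝ) (η : ℝ → ℝ), 0 < z₁ ∧ (∀ z, 0 ≤ η z) ∧ AntitoneOn η (Ioi 0) ∧ Integrable η ∧
      ∫ z, η z ≤ δ ∧ ∀ z ∈ Ioo 0 z₁, ENNReal.ofReal (η z) = k z := by
  obtain ⟨z₁, hz₁, hlt⟩ := exists_lintegral_Ioo_lt hfin (ENNReal.ofReal_pos.mpr hδ)
  have hne : ∫⁻ z in Ioo 0 z₁, k z ≠ ⊤ := hlt.ne_top
  have hk_ne {z : ℝ} (hz : z ∈ Ioo 0 z₁) : k z ≠ ⊤ :=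
    ne_top_of_antitone_of_lintegral_ne_top hk hne hz
  let η := (Ioo 0 z₁).indicator fun z => (k z).toReal
  have hη {z : ℝ} (hz : z ∈ Ioo 0 z₁) : η z = (k z).toReal := indicator_of_mem hz _
  have hη₀ (z : ℝ) : 0 ≤ η z := indicator_nonneg (fun _ _ => ENNReal.toReal_nonneg) z
  refine ⟨z₁, η, hz₁, hη₀, fun x hx y hy hxy => ?_, ?_, ?_, fun z hz => ?_⟩
  · by_cases hyz : y < z₁
    · have hx' : x ∈ Ioo 0 z₁ := ⟨hx, hxy.trans_lt hyz⟩
      rw [hη hx', hη ⟨hy, hyz⟩]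
      exact ENNReal.toReal_mono (hk_ne hx') (hk hxy)
    · exact (indicator_of_notMem (fun h => hyz h.2) _).trans_le (hη₀ x)
  · rw [integrable_indicator_iff measurableSet_Ioo]
    exact integrable_toReal_of_lintegral_ne_top hk.measurable.aemeasurable hne
  · rw [integral_indicator measurableSet_Ioo, integral_toReal hk.measurable.aemeasurable
      ((ae_restrict_iff' measurableSet_Ioo).mpr
        (Eventually.of_forall fun z hz => (hk_ne hz).lt_top))]
    exact ENNReal.toReal_le_of_le_ofReal hδ.le hlt.le
  · rw [hη hz, ENNReal.ofReal_toReal (hk_ne hz)]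

omit hk

variable {n : ℕ} [NeZero n] {f : (Fin n → ℝ) → ℝ} {α : ℝ}

lemma gInv_mono : Monotone (gInv f α) := fun _ _ h =>
  iInf_mono fun _ => iInf_mono' fun hx => ⟨⟨hx.1, h.trans hx.2⟩, le_rfl⟩

lemma gFun_lt_of_lt_gInv {x z : ℝ} (hx : 0 ≤ x) (h : ENNReal.ofReal x < gInv f α z) :
    gFun f α x < z := by
  by_contra! hz
  exact h.not_ge (iInf₂_le x ⟨hx, hz⟩)

lemma CylindricalDegeneracy.exists_capProfile (h : CylindricalDegeneracy f α) :
    ∃ z₁ : ℝ, 0 < z₁ ∧ (∀ z ∈ Ioo 0 z₁, ENNReal.ofReal (1000 * z) ≤ gInv f α z) ∧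
      ∀ ε, 0 < ε → ε ≤ 1 / 8 → ∃ c : CapProfile ε,
        ∀ s, c.p s < z₁ → ENNReal.ofReal (1000 * c.p' s) ≤ gInv f α (c.p s) := by
  obtain ⟨z₁, η, hz₁, hη₀, hanti, hinteg, hle, hη⟩ := exists_integrable_antitoneOn_eq
    (k := fun z => (gInv f α z)⁻¹) (fun _ _ h => ENNReal.inv_le_inv.mpr (gInv_mono h)) h
    (δ := 1 / 64000) (by norm_num)
  have hη₀' (z : ℝ) : 0 ≤ 1000 * η z := mul_nonneg (by norm_num) (hη₀ z)
  have hanti' : AntitoneOn (fun z => 1000 * η z) (Ioi 0) := fun x hx y hy hxy =>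
    mul_le_mul_of_nonneg_left (hanti hx hy hxy) (by norm_num)
  have hle' : ∫ z, 1000 * η z ≤ 1 / 64 := by
    rw [integral_const_mul]
    linarith
  have hgInv {z : ℝ} (hz : z ∈ Ioo 0 z₁) {c : ℝ} (hc : 0 ≤ c) (hcη : c * (1000 * η z) ≤ 1) :
      ENNReal.ofReal (1000 * c) ≤ gInv f α z := by
    rw [← inv_inv (gInv f α z), ← hη z hz, ENNReal.le_inv_iff_mul_le,
      ← ENNReal.ofReal_mul (by positivity)]
    exact ENNReal.ofReal_le_one.mpr (by linarith)
  obtain ⟨μ, hμ, hημ⟩ := exists_isCapDensity hη₀' hanti' (hinteg.const_mul 1000) hle'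
  refine ⟨z₁, hz₁, fun z hz => hgInv hz hz.1.le ?_, fun ε hε hε' => ?_⟩
  · linarith [mul_le_two_mul_integral hη₀' hanti' (hinteg.const_mul 1000) hz.1]
  · obtain ⟨c, hc⟩ := hμ.exists_capProfile hε hε'
    refine ⟨c, fun s hs => hgInv ⟨c.deriv_pos s, hs⟩ (c.deriv_deriv_pos s).le ?_⟩
    exact (mul_le_mul_of_nonneg_left (hημ _ (c.deriv_pos s)) (c.deriv_deriv_pos s).le).trans (hc s)

end GInv

section CapInequality

lemma exists_rpow_le_one_add {a b : ℝ} (ha : 0 < a) (h₁ : (1 : ℝ) ∈ Icc a b) (e : ℝ) :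
    ∃ Λ : ℝ, 0 ≤ Λ ∧ ∀ z ∈ Icc a b, z ^ e ≤ 1 + Λ * |z - 1| := by
  have hsmooth : ContDiffOn ℝ 1 (fun z : ℝ => z ^ e) (Icc a b) :=
    contDiffOn_id.rpow_const_of_ne fun z hz => (ha.trans_le hz.1).ne'
  obtain ⟨K, hK⟩ := hsmooth.exists_lipschitzOnWith one_ne_zero (convex_Icc a b) isCompact_Icc
  refine ⟨K, K.2, fun z hz => ?_⟩
  have hdist := hK.dist_le_mul z hz 1 h₁
  rw [Real.one_rpow, Real.dist_eq, Real.dist_eq] at hdist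
  linarith [(abs_le.mp hdist).2]

namespace CapProfile

variable {ε : ℝ} (c : CapProfile ε) {s₁ s₂ : ℝ}

lemma strictMono_deriv : StrictMono c.p := strictMono_of_deriv_pos fun s => by
  rw [(c.hasDerivAt_deriv s).deriv]
  exact c.deriv_deriv_pos s

/-- `normalSq` of the two-sided cap of radius `1`, at the point with positions `s₁` and `s₂` on
its two ends. -/
noncomputable def normalSq (s₁ s₂ : ℝ) : ℝ :=
  _root_.normalSq 1 (c.V s₁ + c.V s₂) (c.p s₁ - c.p s₂)

/-- `curvatureRatio` of the two-sided cap of radius `1`. -/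
noncomputable def curvatureRatio (s₁ s₂ : ℝ) : ℝ :=
  _root_.curvatureRatio 1 (c.V s₁ + c.V s₂) (c.p s₁ - c.p s₂) (c.p' s₁ + c.p' s₂)

/-- The speed of the two-sided cap of radius `1`, multiplied by the length of the normal. -/
noncomputable def rescaledSpeed {n : ℕ} [NeZero n] (f : (Fin n → ℝ) → ℝ) (α s₁ s₂ : ℝ) : ℝ :=
  c.normalSq s₁ s₂ ^ ((1 - α) / 2) * fHat f (c.curvatureRatio s₁ s₂) ^ α

lemma normalSq_comm (s₁ s₂ : ℝ) : c.normalSq s₁ s₂ = c.normalSq s₂ s₁ := by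
  simp only [normalSq, _root_.normalSq]
  ring

lemma rescaledSpeed_comm {n : ℕ} [NeZero n] (f : (Fin n → ℝ) → ℝ) (α s₁ s₂ : ℝ) :
    c.rescaledSpeed f α s₁ s₂ = c.rescaledSpeed f α s₂ s₁ := by
  have hratio : c.curvatureRatio s₁ s₂ = c.curvatureRatio s₂ s₁ := by
    have hN := c.normalSq_comm s₁ s₂
    rw [normalSq, normalSq] at hN
    simp only [curvatureRatio, _root_.curvatureRatio, hN]
    ring
  rw [rescaledSpeed, rescaledSpeed, hratio, normalSq_comm]

/-- The positions on the two ends of a two-sided cap at a point lying on the side of the first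
end. -/
structure IsPosition (s₁ s₂ : ℝ) : Prop where
  le : s₂ ≤ s₁
  add_le : s₁ + s₂ ≤ -1
  height_le : c.V s₁ + c.V s₂ ≤ 1

namespace IsPosition

variable {c} (h : c.IsPosition s₁ s₂)

include h

lemma deriv_right_le : c.p s₂ ≤ 1 / 8 := c.deriv_le_eighth (by linarith [h.le, h.add_le])

lemma deriv_left_le : c.p s₁ ≤ 17 :=
  c.deriv_le_of_le_one s₁ (by linarith [h.height_le, c.pos s₂])

lemma deriv_le : c.p s₂ ≤ c.p s₁ := c.strictMono_deriv.monotone h.le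

lemma sq_sub_le : (c.p s₁ - c.p s₂) ^ 2 ≤ c.p s₁ ^ 2 :=
  pow_le_pow_left₀ (sub_nonneg.mpr h.deriv_le) (sub_le_self _ (c.deriv_pos s₂).le) 2

lemma sq_deriv_le : c.p s₁ ^ 2 ≤ 17 * c.p s₁ := by
  rw [sq]
  exact mul_le_mul_of_nonneg_right h.deriv_left_le (c.deriv_pos s₁).le

lemma normalSq_mem_Icc : c.normalSq s₁ s₂ ∈ Icc (1 / 64) 80 := by
  have hV := h.height_le
  have hsq_nonneg := sq_nonneg (c.p s₁ - c.p s₂)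
  rw [normalSq, _root_.normalSq]
  constructor
  · rcases le_or_gt (c.V s₁ + c.V s₂) (1 / 2) with hlow | hhigh
    · linarith
    · have hgap : 1 / 4 ≤ c.p s₁ - c.p s₂ := by
        linarith [c.le_deriv s₁, c.le_deriv s₂, h.deriv_right_le]
      linarith [pow_le_pow_left₀ (by norm_num) hgap 2]
  · linarith [h.sq_sub_le, h.sq_deriv_le, h.deriv_left_le, c.pos s₁, c.pos s₂]

lemma normalSq_pos : 0 < c.normalSq s₁ s₂ := lt_of_lt_of_le (by norm_num) h.normalSq_mem_Icc.1

lemma abs_normalSq_sub_one_le : |c.normalSq s₁ s₂ - 1| ≤ 7 * c.p s₁ := by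
  have hV : c.V s₁ + c.V s₂ ≤ 2 * c.p s₁ := by
    linarith [c.le_deriv s₁, c.le_deriv s₂, h.deriv_le]
  have hp := c.deriv_pos s₁
  rw [normalSq, _root_.normalSq, abs_le]
  constructor
  · linarith [sq_nonneg (c.p s₁ - c.p s₂)]
  · linarith [h.sq_sub_le, h.sq_deriv_le, c.pos s₁, c.pos s₂]

lemma curvatureRatio_nonneg : 0 ≤ c.curvatureRatio s₁ s₂ := by
  have hsecond := add_pos (c.deriv_deriv_pos s₁) (c.deriv_deriv_pos s₂)
  have hV : 0 ≤ 1 - (c.V s₁ + c.V s₂) := sub_nonneg.mpr h.height_le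
  exact div_nonneg (by positivity) h.normalSq_pos.le

lemma curvatureRatio_le :
    c.curvatureRatio s₁ s₂ ≤ 64 * (c.p s₁ ^ 2 / 4 + (c.p' s₁ + c.p' s₂) / 2) := by
  have hsecond := add_pos (c.deriv_deriv_pos s₁) (c.deriv_deriv_pos s₂)
  have hV : 0 < c.V s₁ + c.V s₂ := add_pos (c.pos s₁) (c.pos s₂)
  have hN := mul_le_mul_of_nonneg_left h.normalSq_mem_Icc.1
    (by positivity : 0 ≤ c.p s₁ ^ 2 / 4 + (c.p' s₁ + c.p' s₂) / 2)
  rw [curvatureRatio, _root_.curvatureRatio, ← normalSq, div_le_iff₀ h.normalSq_pos]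
  linarith [h.sq_sub_le, mul_nonneg hsecond.le hV.le]

variable {n : ℕ} [NeZero n] {f : (Fin n → ℝ) → ℝ} {α z₁ Λ : ℝ}

lemma gFun_curvatureRatio_lt (hz : ENNReal.ofReal (1000 * c.p s₁) ≤ gInv f α (c.p s₁))
    (h₁ : ENNReal.ofReal (1000 * c.p' s₁) ≤ gInv f α (c.p s₁))
    (h₂ : ENNReal.ofReal (1000 * c.p' s₂) ≤ gInv f α (c.p s₂)) :
    gFun f α (c.curvatureRatio s₁ s₂) < c.p s₁ := by
  have hx := h.curvatureRatio_nonneg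
  refine gFun_lt_of_lt_gInv hx ?_
  by_contra! hle
  have hp := (ENNReal.ofReal_le_ofReal_iff hx).mp (hz.trans hle)
  have hp₁ := (ENNReal.ofReal_le_ofReal_iff hx).mp (h₁.trans hle)
  have hp₂ := (ENNReal.ofReal_le_ofReal_iff hx).mp ((h₂.trans (gInv_mono h.deriv_le)).trans hle)
  linarith [h.curvatureRatio_le, h.sq_deriv_le, c.deriv_pos s₁]

lemma rescaledSpeed_le_of_gFun_lt (hf : IsSpeedFunction f) (hΛ : 0 ≤ Λ)
    (hpow : ∀ z ∈ Icc (1 / 64 : ℝ) 80, z ^ ((1 - α) / 2) ≤ 1 + Λ * |z - 1|)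
    (hg : gFun f α (c.curvatureRatio s₁ s₂) < c.p s₁) :
    c.rescaledSpeed f α s₁ s₂ ≤ fHat f 0 ^ α * (1 - (c.V s₁ + c.V s₂)) +
      (1 + 7 * Λ * fHat f 0 ^ α + 119 * Λ + 2 * fHat f 0 ^ α) * c.p s₁ := by
  have hp := c.deriv_pos s₁
  set F := fHat f 0 ^ α with hF
  have hF₀ : 0 ≤ F := Real.rpow_nonneg hf.fHat_zero_nonneg _
  have hf₀ := Real.rpow_nonneg (hf.fHat_nonneg h.curvatureRatio_nonneg) α
  have hfF : fHat f (c.curvatureRatio s₁ s₂) ^ α ≤ F + c.p s₁ := by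
    rw [gFun, ← hF] at hg
    linarith
  have hN : c.normalSq s₁ s₂ ^ ((1 - α) / 2) ≤ 1 + Λ * (7 * c.p s₁) :=
    (hpow _ h.normalSq_mem_Icc).trans (by gcongr; exact h.abs_normalSq_sub_one_le)
  have hV : F * (c.V s₁ + c.V s₂) ≤ F * (2 * c.p s₁) := mul_le_mul_of_nonneg_left
    (by linarith [c.le_deriv s₁, c.le_deriv s₂, h.deriv_le]) hF₀
  calc c.rescaledSpeed f α s₁ s₂
      ≤ (1 + Λ * (7 * c.p s₁)) * (F + c.p s₁) := mul_le_mul hN hfF hf₀ (by positivity)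
    _ ≤ _ := by linarith [mul_le_mul_of_nonneg_left h.sq_deriv_le hΛ]

lemma rescaledSpeed_le_of_le (hf : IsSpeedFunction f) (hα : 0 < α) (hz₁ : 0 < z₁) (hΛ : 0 ≤ Λ)
    (hpow : ∀ z ∈ Icc (1 / 64 : ℝ) 80, z ^ ((1 - α) / 2) ≤ 1 + Λ * |z - 1|)
    (hle : z₁ ≤ c.p s₁) :
    c.rescaledSpeed f α s₁ s₂ ≤ (1 + 119 * Λ) * fHat f 10000 ^ α / z₁ * c.p s₁ := by
  have hx := h.curvatureRatio_nonneg
  have hN : c.normalSq s₁ s₂ ^ ((1 - α) / 2) ≤ 1 + 119 * Λ := by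
    have := mul_le_mul_of_nonneg_left (h.abs_normalSq_sub_one_le.trans
      (mul_le_mul_of_nonneg_left h.deriv_left_le (by norm_num))) hΛ
    linarith [hpow _ h.normalSq_mem_Icc]
  have hx_le : c.curvatureRatio s₁ s₂ ≤ 10000 := by
    linarith [h.curvatureRatio_le, h.sq_deriv_le, h.deriv_left_le, h.deriv_right_le,
      c.deriv_deriv_le s₁, c.deriv_deriv_le s₂]
  have hY : 0 ≤ fHat f 10000 ^ α := Real.rpow_nonneg (hf.fHat_nonneg (by norm_num)) _
  calc c.rescaledSpeed f α s₁ s₂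
      ≤ (1 + 119 * Λ) * fHat f 10000 ^ α :=
        mul_le_mul hN (Real.rpow_le_rpow (hf.fHat_nonneg hx) (hf.fHat_mono hx hx_le) hα.le)
          (Real.rpow_nonneg (hf.fHat_nonneg hx) _) (by positivity)
    _ = (1 + 119 * Λ) * fHat f 10000 ^ α / z₁ * z₁ := (div_mul_cancel₀ _ hz₁.ne').symm
    _ ≤ _ := by gcongr

end IsPosition

end CapProfile

variable {n : ℕ} [NeZero n] {f : (Fin n → ℝ) → ℝ} {α : ℝ}

/-- There are arbitrarily flat cap profiles whose speed exceeds that of the cylinder by at most `C`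
times the total slope. -/
def HasCapBarriers (f : (Fin n → ℝ) → ℝ) (α C : ℝ) : Prop :=
  ∀ ε, 0 < ε → ε ≤ 1 / 8 → ∃ c : CapProfile ε, ∀ s₁ s₂, s₁ + s₂ ≤ -1 → c.V s₁ + c.V s₂ ≤ 1 →
    c.rescaledSpeed f α s₁ s₂ ≤
      fHat f 0 ^ α * (1 - (c.V s₁ + c.V s₂)) + C * (c.p s₁ + c.p s₂)

lemma IsSpeedFunction.exists_hasCapBarriers (hf : IsSpeedFunction f) (hα : 0 < α)
    (hI : CylindricalDegeneracy f α) : ∃ C > 0, HasCapBarriers f α C := by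
  obtain ⟨z₁, hz₁, hz, hprofile⟩ := hI.exists_capProfile
  obtain ⟨Λ, hΛ, hpow⟩ := exists_rpow_le_one_add (a := 1 / 64) (b := 80) (by norm_num)
    (by norm_num) ((1 - α) / 2)
  set F := fHat f 0 ^ α
  have hF : 0 ≤ F := Real.rpow_nonneg hf.fHat_zero_nonneg _
  have hY : 0 ≤ fHat f 10000 ^ α := Real.rpow_nonneg (hf.fHat_nonneg (by norm_num)) _
  set C₁ := 1 + 7 * Λ * F + 119 * Λ + 2 * F
  set C₂ := (1 + 119 * Λ) * fHat f 10000 ^ α / z₁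
  have : 0 < C₁ := by positivity
  have : 0 ≤ C₂ := by positivity
  refine ⟨C₁ + C₂, by positivity, fun ε hε hε' => ?_⟩
  obtain ⟨c, hc⟩ := hprofile ε hε hε'
  have hspeed {s₁ s₂ : ℝ} (h : c.IsPosition s₁ s₂) : c.rescaledSpeed f α s₁ s₂ ≤
      F * (1 - (c.V s₁ + c.V s₂)) + (C₁ + C₂) * (c.p s₁ + c.p s₂) := by
    have hp₁ := c.deriv_pos s₁
    have hp₂ := c.deriv_pos s₂
    have hV := mul_nonneg hF (sub_nonneg.mpr h.height_le)
    have hrest : 0 ≤ C₁ * c.p s₁ ∧ 0 ≤ C₂ * c.p s₁ ∧ 0 ≤ (C₁ + C₂) * c.p s₂ := by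
      refine ⟨?_, ?_, ?_⟩ <;> positivity
    rcases lt_or_ge (c.p s₁) z₁ with hlt | hge
    · have hg := h.gFun_curvatureRatio_lt (hz _ ⟨hp₁, hlt⟩) (hc s₁ hlt)
        (hc s₂ (h.deriv_le.trans_lt hlt))
      linarith [h.rescaledSpeed_le_of_gFun_lt hf hΛ hpow hg]
    · linarith [h.rescaledSpeed_le_of_le hf hα hz₁ hΛ hpow hge]
  refine ⟨c, fun s₁ s₂ hs hV => ?_⟩
  rcases le_total s₂ s₁ with hle | hle
  · exact hspeed ⟨hle, hs, hV⟩
  · rw [c.rescaledSpeed_comm, add_comm (c.V s₁), add_comm (c.p s₁)]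
    exact hspeed ⟨hle, by rwa [add_comm], by rwa [add_comm]⟩

end CapInequality

section CapFamilies

/-- The motion of a cylinder with two closed-up ends: its radius is `shrinkingRadius α Z k a`, and
its ends start at distance `(1 - β * (t - a)) * R` from the center. -/
structure CapMotion (α a b : ℝ) where
  Z : ℝ
  k : ℝ
  β : ℝ
  exponent_pos : 0 < α
  lt : a < b
  radius_pos : ∀ t ∈ Icc a b, 0 < Z - k * (t - a)
  loss_nonneg : 0 ≤ β
  loss_le : β * (b - a) ≤ 1 / 2

namespace CapMotion

variable {α a b : ℝ} (m : CapMotion α a b) {t : ℝ} (y₀ σ y : ℝ)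

/-- The radius of the cylinder. -/
noncomputable def R (t : ℝ) : ℝ := shrinkingRadius α m.Z m.k a t

/-- The time derivative of the radius. -/
noncomputable def R' (t : ℝ) : ℝ := shrinkingRadiusDeriv α m.Z m.k a t

/-- The position at height `y` on the upper (`σ = 1`) or lower (`σ = -1`) end of the cylinder with
center at height `y₀`. -/
noncomputable def coord (y₀ σ t y : ℝ) : ℝ := σ * (y - y₀) / m.R t - (1 - m.β * (t - a))

lemma R_pos (ht : t ∈ Icc a b) : 0 < m.R t := shrinkingRadius_pos (m.radius_pos t ht)

lemma hasDerivAt_R (ht : t ∈ Icc a b) : HasDerivAt m.R (m.R' t) t :=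
  hasDerivAt_shrinkingRadius m.exponent_pos (m.radius_pos t ht)

lemma coord_add_coord_neg_le (ht : t ∈ Icc a b) : m.coord y₀ 1 t y + m.coord y₀ (-1) t y ≤ -1 := by
  have hloss : m.β * (t - a) ≤ m.β * (b - a) :=
    mul_le_mul_of_nonneg_left (sub_le_sub_right ht.2 a) m.loss_nonneg
  have hsum : m.coord y₀ 1 t y + m.coord y₀ (-1) t y = -(2 * (1 - m.β * (t - a))) := by
    simp only [coord]
    ring
  linarith [m.loss_le]

lemma hasDerivAt_coord (t : ℝ) : HasDerivAt (m.coord y₀ σ t) (σ / m.R t) y := by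
  have := ((((hasDerivAt_id y).sub_const y₀).const_mul σ).div_const (m.R t)).sub_const
    (1 - m.β * (t - a))
  exact this.congr_deriv (by rw [mul_one])

lemma hasDerivAt_coord_time (ht : t ∈ Icc a b) :
    HasDerivAt (fun t => m.coord y₀ σ t y)
      (-(σ * (y - y₀) * m.R' t) / m.R t ^ 2 + m.β) t := by
  have hloss : HasDerivAt (fun t => 1 - m.β * (t - a)) (-m.β) t := by
    simpa using! (((hasDerivAt_id t).sub_const a).const_mul m.β).const_sub 1
  refine (((hasDerivAt_const t (σ * (y - y₀))).div (m.hasDerivAt_R ht)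
    (m.R_pos ht).ne').sub hloss).congr_deriv ?_
  ring

lemma contDiffOn_coord :
    ContDiffOn ℝ ∞ (fun q : ℝ × ℝ => m.coord y₀ σ q.1 q.2) (Icc a b ×ˢ univ) := by
  have hR : ContDiffOn ℝ ∞ (fun q : ℝ × ℝ => m.R q.1) (Icc a b ×ˢ univ) :=
    (contDiffOn_shrinkingRadius m.radius_pos).comp contDiffOn_fst fun q hq => hq.1
  refine ContDiffOn.sub (ContDiffOn.div ?_ hR fun q hq => (m.R_pos hq.1).ne') ?_ <;> fun_prop

end CapMotion

namespace CapProfile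

variable {ε α a b : ℝ} (c : CapProfile ε) (m : CapMotion α a b) (y₀ : ℝ) {t : ℝ}

/-- The solids of revolution obtained by closing up both ends of a shrinking cylinder with the
cap `c`. -/
noncomputable def family : ProfileFamily a b where
  R := m.R
  R' := m.R'
  v t y := c.V (m.coord y₀ 1 t y) + c.V (m.coord y₀ (-1) t y)
  v₁ t y := (c.p (m.coord y₀ 1 t y) - c.p (m.coord y₀ (-1) t y)) / m.R t
  v₂ t y := (c.p' (m.coord y₀ 1 t y) + c.p' (m.coord y₀ (-1) t y)) / m.R t ^ 2
  vₜ t y := c.p (m.coord y₀ 1 t y) * (-((y - y₀) * m.R' t) / m.R t ^ 2 + m.β) +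
    c.p (m.coord y₀ (-1) t y) * ((y - y₀) * m.R' t / m.R t ^ 2 + m.β)
  lt := m.lt
  pos _ ht := m.R_pos ht
  smooth_radius := contDiffOn_shrinkingRadius m.radius_pos
  deriv_radius _ ht := (m.hasDerivAt_R ht).hasDerivWithinAt
  smooth := (c.smooth.comp_contDiffOn (m.contDiffOn_coord y₀ 1)).add
    (c.smooth.comp_contDiffOn (m.contDiffOn_coord y₀ (-1)))
  deriv_one t _ y := by
    refine (((c.hasDerivAt _).comp y (m.hasDerivAt_coord y₀ 1 y t)).add
      ((c.hasDerivAt _).comp y (m.hasDerivAt_coord y₀ (-1) y t))).congr_deriv ?_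
    ring
  deriv_two t _ y := by
    refine ((((c.hasDerivAt_deriv _).comp y (m.hasDerivAt_coord y₀ 1 y t)).sub
      ((c.hasDerivAt_deriv _).comp y
        (m.hasDerivAt_coord y₀ (-1) y t))).div_const (m.R t)).congr_deriv ?_
    ring
  deriv_time t ht y := by
    refine (((c.hasDerivAt _).comp t (m.hasDerivAt_coord_time y₀ 1 y ht)).add
      ((c.hasDerivAt _).comp t
        (m.hasDerivAt_coord_time y₀ (-1) y ht))).hasDerivWithinAt.congr_deriv ?_
    ring
  convex t ht y := div_pos (add_pos (c.deriv_deriv_pos _) (c.deriv_deriv_pos _))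
    (pow_pos (m.R_pos ht) 2)
  regular t ht y hy h₀ := by
    have hp := sub_eq_zero.mp ((div_eq_zero_iff.mp h₀).resolve_right (m.R_pos ht).ne')
    have hcoord := c.strictMono_deriv.injective hp
    have hsum := m.coord_add_coord_neg_le y₀ y ht
    rw [← hcoord] at hy hsum
    linarith [c.deriv_le_eighth (s := m.coord y₀ 1 t y) (by linarith),
      c.le_deriv (m.coord y₀ 1 t y)]

lemma rescaledSpeed_family {n : ℕ} [NeZero n] (f : (Fin n → ℝ) → ℝ) (ht : t ∈ Icc a b) (y : ℝ) :
    (c.family m y₀).rescaledSpeed f α t y =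
      c.rescaledSpeed f α (m.coord y₀ 1 t y) (m.coord y₀ (-1) t y) := by
  have hR := (m.R_pos ht).ne'
  have hN : (c.family m y₀).normalSq t y =
      c.normalSq (m.coord y₀ 1 t y) (m.coord y₀ (-1) t y) := by
    simp only [ProfileFamily.normalSq, normalSq, _root_.normalSq, family]
    field_simp
  have hratio : (c.family m y₀).curvatureRatio t y =
      c.curvatureRatio (m.coord y₀ 1 t y) (m.coord y₀ (-1) t y) := by
    rw [ProfileFamily.curvatureRatio, curvatureRatio, _root_.curvatureRatio, _root_.curvatureRatio,
      ← ProfileFamily.normalSq, ← normalSq, hN]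
    simp only [family]
    field_simp
  rw [ProfileFamily.rescaledSpeed, hN, hratio, rescaledSpeed]

lemma deriv_sub_mul_nonneg (ht : t ∈ Icc a b) (y : ℝ) :
    0 ≤ (c.p (m.coord y₀ 1 t y) - c.p (m.coord y₀ (-1) t y)) * (y - y₀) := by
  have hR := m.R_pos ht
  rcases le_total y₀ y with h | h
  · refine mul_nonneg (sub_nonneg.mpr (c.strictMono_deriv.monotone ?_)) (sub_nonneg.mpr h)
    exact sub_le_sub_right (div_le_div_of_nonneg_right (by linarith) hR.le) _
  · refine mul_nonneg_of_nonpos_of_nonpos (sub_nonpos.mpr (c.strictMono_deriv.monotone ?_))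
      (sub_nonpos.mpr h)
    exact sub_le_sub_right (div_le_div_of_nonneg_right (by linarith) hR.le) _

lemma le_rescaledVelocity_family (hk : 0 ≤ m.k) {C : ℝ}
    (hC : 2 * C ≤ (m.Z - m.k * (t - a)) * m.β) (ht : t ∈ Icc a b) (y : ℝ) :
    m.k / (1 + α) * (1 - (c.family m y₀).v t y) +
        C * (c.p (m.coord y₀ 1 t y) + c.p (m.coord y₀ (-1) t y)) ≤
      (c.family m y₀).rescaledVelocity α t y := by
  have hα := m.exponent_pos
  have hR := m.R_pos ht
  have hRα : 0 < m.R t ^ α := Real.rpow_pos_of_pos hR _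
  have hpow : m.R t ^ α * m.R t = m.Z - m.k * (t - a) := by
    rw [← Real.rpow_add_one hR.ne', add_comm α 1]
    exact shrinkingRadius_rpow hα (m.radius_pos t ht).le
  have hderiv : m.R t ^ α * -m.R' t = m.k / (1 + α) :=
    shrinkingRadius_rpow_mul_deriv (m.radius_pos t ht)
  have hshrink : 0 ≤ -m.R' t := nonneg_of_mul_nonneg_right (hderiv ▸ by positivity) hRα
  have htilt : 0 ≤ m.R t ^ α * ((c.p (m.coord y₀ 1 t y) - c.p (m.coord y₀ (-1) t y)) * (y - y₀)) *
      -m.R' t / (2 * m.R t) := by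
    have := c.deriv_sub_mul_nonneg m y₀ ht y
    positivity
  have hp := add_pos (c.deriv_pos (m.coord y₀ 1 t y)) (c.deriv_pos (m.coord y₀ (-1) t y))
  have hloss := mul_le_mul_of_nonneg_right hC hp.le
  calc _ ≤ m.R t ^ α * -m.R' t * (1 - (c.family m y₀).v t y) +
        m.R t ^ α * m.R t * m.β * (c.p (m.coord y₀ 1 t y) + c.p (m.coord y₀ (-1) t y)) / 2 +
        m.R t ^ α * ((c.p (m.coord y₀ 1 t y) - c.p (m.coord y₀ (-1) t y)) * (y - y₀)) *
          -m.R' t / (2 * m.R t) := by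
        rw [hderiv, hpow]
        linarith
    _ = _ := by
        simp only [ProfileFamily.rescaledVelocity, family]
        field_simp
        ring

lemma solidOfRevolution_family_subset {n : ℕ} {ℓ : ℝ} (hy₀ : |y₀| + 2 * m.R a < ℓ) :
    solidOfRevolution n (m.R a) ((c.family m y₀).v a) ⊆ openCylinder n (m.R a) ℓ := by
  intro x hx
  have hR := m.R_pos (left_mem_Icc.mpr m.lt.le)
  have hx' : radialSq x / m.R a ^ 2 + (c.V (m.coord y₀ 1 a (x (Fin.last n))) +
    c.V (m.coord y₀ (-1) a (x (Fin.last n)))) ≤ 1 := hx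
  have hV₁ := c.pos (m.coord y₀ 1 a (x (Fin.last n)))
  have hV₂ := c.pos (m.coord y₀ (-1) a (x (Fin.last n)))
  have hradial : 0 ≤ radialSq x / m.R a ^ 2 := div_nonneg (radialSq_nonneg x) (sq_nonneg _)
  have hupper := c.le_of_le_one (m.coord y₀ 1 a (x (Fin.last n))) (by linarith)
  have hlower := c.le_of_le_one (m.coord y₀ (-1) a (x (Fin.last n))) (by linarith)
  simp only [CapMotion.coord, sub_self, mul_zero, sub_zero] at hupper hlower
  rw [sub_le_iff_le_add, div_le_iff₀ hR] at hupper hlower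
  refine ⟨(div_lt_one (by positivity)).mp (by linarith : radialSq x / m.R a ^ 2 < 1), ?_, ?_⟩
  · linarith [neg_abs_le y₀]
  · linarith [le_abs_self y₀]

lemma mem_solidOfRevolution_family {n : ℕ} {x : AmbientSpace n} (ht : t ∈ Icc a b)
    (hx : radialSq x / m.R t ^ 2 + 4 * ε ≤ 1) :
    x ∈ solidOfRevolution n (m.R t) ((c.family m (x (Fin.last n))).v t) := by
  have hε := c.param_pos
  set s := m.coord (x (Fin.last n)) 1 t (x (Fin.last n)) with hs
  have hs' : m.coord (x (Fin.last n)) (-1) t (x (Fin.last n)) = s := by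
    simp [hs, CapMotion.coord]
  have hsum := m.coord_add_coord_neg_le (x (Fin.last n)) (x (Fin.last n)) ht
  rw [hs'] at hsum
  have hV : c.V s ≤ 2 * ε := calc
    c.V s ≤ c.p s := c.le_deriv s
    _ ≤ Real.exp (-(1 / (2 * ε))) := c.deriv_le_exp s (by linarith)
    _ ≤ (1 / (2 * ε))⁻¹ := by
      rw [Real.exp_neg]
      exact inv_anti₀ (by positivity) (by linarith [Real.add_one_le_exp (1 / (2 * ε))])
    _ = 2 * ε := by rw [one_div, inv_inv]
  change radialSq x / m.R t ^ 2 +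
    (c.V s + c.V (m.coord (x (Fin.last n)) (-1) t (x (Fin.last n)))) ≤ 1
  rw [hs']
  linarith

variable {n : ℕ} [NeZero n] {f : (Fin n → ℝ) → ℝ} {C : ℝ}

lemma isSmoothSubsolution_family (hf : IsSpeedFunction f)
    (hspeed : ∀ s₁ s₂, s₁ + s₂ ≤ -1 → c.V s₁ + c.V s₂ ≤ 1 → c.rescaledSpeed f α s₁ s₂ ≤
      fHat f 0 ^ α * (1 - (c.V s₁ + c.V s₂)) + C * (c.p s₁ + c.p s₂))
    (hk : m.k = (1 + α) * fHat f 0 ^ α)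
    (hC : ∀ t ∈ Icc a b, 2 * C ≤ (m.Z - m.k * (t - a)) * m.β) :
    IsSmoothSubsolution f α a b fun t => solidOfRevolution n (m.R t) ((c.family m y₀).v t) := by
  have hα := m.exponent_pos
  have hF : 0 ≤ fHat f 0 ^ α := Real.rpow_nonneg hf.fHat_zero_nonneg _
  refine (c.family m y₀).isSmoothSubsolution hf fun t ht y hy => ?_
  rw [c.rescaledSpeed_family m y₀ f ht]
  refine (hspeed _ _ (m.coord_add_coord_neg_le y₀ y ht) hy).trans ?_
  have hvelocity := c.le_rescaledVelocity_family m y₀ (hk ▸ by positivity) (hC t ht) ht y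
  rwa [hk, mul_div_cancel_left₀ _ (by positivity)] at hvelocity

end CapProfile

variable {n : ℕ} [NeZero n] {f : (Fin n → ℝ) → ℝ} {α C : ℝ}

lemma openCylinder_mono {n : ℕ} {r r' ℓ ℓ' : ℝ} (hr : 0 ≤ r) (hrr : r ≤ r') (hℓ : ℓ ≤ ℓ') :
    openCylinder n r ℓ ⊆ openCylinder n r' ℓ' := fun _ hx =>
  ⟨hx.1.trans_le (pow_le_pow_left₀ hr hrr 2), by linarith [hx.2.1], by linarith [hx.2.2]⟩

lemma HasCapBarriers.openCylinder_subset (h : HasCapBarriers f α C) (hf : IsSpeedFunction f)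
    {I : Set ℝ} {Ω : ℝ → Set (AmbientSpace n)} (hΩ : IsOuterBarrier f α I Ω) {a b ℓ : ℝ}
    (m : CapMotion α a b) (hI : Icc a b ⊆ I) (hk : m.k = (1 + α) * fHat f 0 ^ α)
    (hC : ∀ t ∈ Icc a b, 2 * C ≤ (m.Z - m.k * (t - a)) * m.β)
    (hin : openCylinder n (m.R a) ℓ ⊆ Ω a) : openCylinder n (m.R b) (ℓ - 2 * m.R a) ⊆ Ω b := by
  intro x hx
  have hb : b ∈ Icc a b := right_mem_Icc.mpr m.lt.le
  have hR := m.R_pos hb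
  have hgap : 0 < 1 - radialSq x / m.R b ^ 2 := by
    rw [sub_pos, div_lt_one (by positivity)]
    exact hx.1
  obtain ⟨c, hc⟩ := h (min (1 / 8) ((1 - radialSq x / m.R b ^ 2) / 4))
    (lt_min (by norm_num) (by positivity)) (min_le_left _ _)
  refine hΩ a b _ m.lt hI (c.isSmoothSubsolution_family m (x (Fin.last n)) hf hc hk hC)
    ((c.solidOfRevolution_family_subset m _ ?_).trans hin) b hb
    (c.mem_solidOfRevolution_family m hb ?_)
  · linarith [abs_lt.mpr ⟨hx.2.1, hx.2.2⟩]
  · linarith [min_le_right (1 / 8) ((1 - radialSq x / m.R b ^ 2) / 4)]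

/-- A time up to which cylindrical pieces survive: a cylindrical piece of `Ω t₀` with the radius
of the shrinking cylinder at time `t₀` keeps shrinking like that cylinder during a time span that
scales like the power `1 + α` of the radius, and meanwhile each of its ends recedes by at most twice
the radius. -/
def IsPersistenceTime (f : (Fin n → ℝ) → ℝ) (α τ : ℝ) : Prop :=
  ∀ (I : Set ℝ) (Ω : ℝ → Set (AmbientSpace n)), IsOuterBarrier f α I Ω →
    ∀ t₀ t ℓ : ℝ, t₀ ≤ t → Icc t₀ t ⊆ I → 0 < 1 - (1 + α) * fHat f 0 ^ α * t₀ →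
      t - t₀ ≤ τ * (1 - (1 + α) * fHat f 0 ^ α * t₀) →
      openCylinder n (cylinderRadius f α t₀) ℓ ⊆ Ω t₀ →
      openCylinder n (cylinderRadius f α t) (ℓ - 2 * cylinderRadius f α t₀) ⊆ Ω t

lemma HasCapBarriers.isPersistenceTime (h : HasCapBarriers f α C) (hf : IsSpeedFunction f)
    (hα : 0 < α) (hC : 0 < C) {τ : ℝ} (hCτ : 8 * C * τ ≤ 1)
    (hkτ : (1 + α) * fHat f 0 ^ α * τ ≤ 1 / 2) : IsPersistenceTime f α τ := by
  intro I Ω hΩ t₀ t ℓ ht hI hZ htτ hin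
  rcases ht.eq_or_lt with rfl | hlt
  · have hr : 0 ≤ cylinderRadius f α t₀ := Real.rpow_nonneg hZ.le _
    exact (openCylinder_mono hr le_rfl (by linarith)).trans hin
  have hk : 0 ≤ (1 + α) * fHat f 0 ^ α :=
    mul_nonneg (by positivity) (Real.rpow_nonneg hf.fHat_zero_nonneg _)
  set k := (1 + α) * fHat f 0 ^ α with hk_def
  set Z := 1 - k * t₀
  have hhalf (s : ℝ) (hs : s ∈ Icc t₀ t) : Z / 2 ≤ Z - k * (s - t₀) := by
    have hks : k * (s - t₀) ≤ k * (τ * Z) := mul_le_mul_of_nonneg_left (by linarith [hs.2]) hk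
    linarith [mul_le_mul_of_nonneg_right hkτ hZ.le]
  let m : CapMotion α t₀ t :=
    { Z := Z, k := k, β := 4 * C / Z
      exponent_pos := hα
      lt := hlt
      radius_pos := fun s hs => (half_pos hZ).trans_le (hhalf s hs)
      loss_nonneg := by positivity
      loss_le := by
        rw [div_mul_eq_mul_div, div_le_iff₀ hZ]
        linarith [mul_le_mul_of_nonneg_left htτ hC.le, mul_le_mul_of_nonneg_right hCτ hZ.le] }
  have hR (s : ℝ) : m.R s = cylinderRadius f α s := by
    rw [CapMotion.R, shrinkingRadius, cylinderRadius, ← hk_def]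
    congr 1
    ring
  rw [← hR] at hin ⊢
  rw [← hR]
  refine h.openCylinder_subset hf hΩ m hI rfl (fun s hs => ?_) hin
  calc 2 * C = Z / 2 * (4 * C / Z) := by field_simp; norm_num
    _ ≤ (Z - k * (s - t₀)) * (4 * C / Z) :=
      mul_le_mul_of_nonneg_right (hhalf s hs) (by positivity)

end CapFamilies

section Persistence

variable {n : ℕ} [NeZero n] {f : (Fin n → ℝ) → ℝ} {α T : ℝ} {Ω : ℝ → Set (AmbientSpace n)}

lemma IsSpeedFunction.exists_isPersistenceTime (hf : IsSpeedFunction f) (hα : 0 < α)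
    (hI : CylindricalDegeneracy f α) :
    ∃ τ > 0, (1 + α) * fHat f 0 ^ α * τ ≤ 1 / 2 ∧ IsPersistenceTime f α τ := by
  obtain ⟨C, hC, hcap⟩ := hf.exists_hasCapBarriers hα hI
  have hk : 0 ≤ (1 + α) * fHat f 0 ^ α :=
    mul_nonneg (by positivity) (Real.rpow_nonneg hf.fHat_zero_nonneg _)
  set k := (1 + α) * fHat f 0 ^ α
  have hden : 0 < 8 * C + 2 * k := by positivity
  have hle : (8 * C + 2 * k) * (1 / (8 * C + 2 * k)) = 1 := mul_one_div_cancel hden.ne'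
  have hCτ : 0 ≤ C * (1 / (8 * C + 2 * k)) := by positivity
  have hkτ : 0 ≤ k * (1 / (8 * C + 2 * k)) := by positivity
  have hhalf : k * (1 / (8 * C + 2 * k)) ≤ 1 / 2 := by linarith
  exact ⟨1 / (8 * C + 2 * k), by positivity, hhalf,
    hcap.isPersistenceTime hf hα hC (by linarith) hhalf⟩

lemma cylinderRadius_zero (f : (Fin n → ℝ) → ℝ) (α : ℝ) : cylinderRadius f α 0 = 1 := by
  simp [cylinderRadius]

lemma cylinderRadius_pos (hk : 0 < (1 + α) * fHat f 0 ^ α) {t : ℝ} (ht : t < collapseTime f α) :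
    0 < cylinderRadius f α t := by
  rw [collapseTime, lt_div_iff₀ hk] at ht
  exact Real.rpow_pos_of_pos (by linarith) _

lemma cylinderRadius_collapseTime (hα : 0 < α) (hk : 0 < (1 + α) * fHat f 0 ^ α) :
    cylinderRadius f α (collapseTime f α) = 0 := by
  rw [cylinderRadius, collapseTime, mul_one_div_cancel hk.ne', sub_self,
    Real.zero_rpow (by positivity)]

lemma continuous_cylinderRadius (hα : 0 < α) : Continuous (cylinderRadius f α) := by
  unfold cylinderRadius
  exact (continuous_const.sub (continuous_const.mul continuous_id)).rpow_const
    fun _ => Or.inr (by positivity)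

lemma IsPersistenceTime.openCylinder_subset_of_le {τ L t : ℝ} (hτ : IsPersistenceTime f α τ)
    (hΩ : IsOuterBarrier f α (Ico 0 T) Ω) (hin : openCylinder n 1 L ⊆ Ω 0) (ht : t ∈ Ico 0 T)
    (htτ : t ≤ τ) : openCylinder n (cylinderRadius f α t) (L - 2) ⊆ Ω t := by
  have hstep := hτ _ Ω hΩ 0 t L ht.1 (Icc_subset_Ico_right ht.2) (by simp) (by simpa using htτ)
    (by rwa [cylinderRadius_zero])
  rwa [cylinderRadius_zero, mul_one] at hstep

/- The times at which `1 - k * t` is the `j`-th power of `Θ = 1 - k * τ` are spaced such that each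
step fits the persistence time; the radii there are the powers of `Θ ^ (1 / (1 + α))`. -/
lemma IsPersistenceTime.openCylinder_subset_of_pow_le {τ L : ℝ} (hτ : IsPersistenceTime f α τ)
    (hk : 0 < (1 + α) * fHat f 0 ^ α) (hτ₀ : 0 ≤ τ) (hkτ : (1 + α) * fHat f 0 ^ α * τ < 1)
    (hΩ : IsOuterBarrier f α (Ico 0 T) Ω) (hin : openCylinder n 1 L ⊆ Ω 0) (j : ℕ) :
    ∀ t ∈ Ico 0 T, (1 - (1 + α) * fHat f 0 ^ α * τ) ^ j ≤ 1 - (1 + α) * fHat f 0 ^ α * t →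
      openCylinder n (cylinderRadius f α t)
        (L - 2 * ∑ i ∈ Finset.range j, cylinderRadius f α τ ^ i) ⊆ Ω t := by
  set k := (1 + α) * fHat f 0 ^ α with hk_def
  set Θ := 1 - k * τ with hΘ_def
  have hΘ : 0 < Θ := by linarith
  have hΘ_le : Θ ≤ 1 := sub_le_self _ (by positivity)
  induction j with
  | zero =>
    intro t ht htk
    rw [pow_zero] at htk
    obtain rfl : t = 0 := le_antisymm (nonpos_of_mul_nonpos_right (by linarith) hk) ht.1
    simpa [cylinderRadius_zero] using hin
  | succ j ih =>
    intro t ht htk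
    have hΘj : 0 < Θ ^ j := pow_pos hΘ j
    have hradius : cylinderRadius f α τ ^ j = (Θ ^ j) ^ (1 / (1 + α)) :=
      Real.rpow_pow_comm hΘ.le _ j
    have hsum : L - 2 * ∑ i ∈ Finset.range (j + 1), cylinderRadius f α τ ^ i =
        L - 2 * ∑ i ∈ Finset.range j, cylinderRadius f α τ ^ i - 2 * cylinderRadius f α τ ^ j := by
      rw [Finset.sum_range_succ]
      ring
    rw [hsum]
    rcases le_or_gt (Θ ^ j) (1 - k * t) with hle | hlt
    · have hr : 0 ≤ cylinderRadius f α τ ^ j := hradius ▸ Real.rpow_nonneg hΘj.le _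
      refine (openCylinder_mono ?_ le_rfl (by linarith)).trans (ih t ht hle)
      exact Real.rpow_nonneg (hΘj.le.trans hle) _
    obtain ⟨t₀, ht₀⟩ : ∃ t₀, 1 - k * t₀ = Θ ^ j := ⟨(1 - Θ ^ j) / k, by field_simp; ring⟩
    have ht₀t : t₀ ≤ t := le_of_mul_le_mul_left (by linarith) hk
    have ht₀_nonneg : 0 ≤ t₀ := nonneg_of_mul_nonneg_right
      (by linarith [pow_le_one₀ (n := j) hΘ.le hΘ_le]) hk
    have hstep : t - t₀ ≤ τ * (1 - k * t₀) := by
      refine le_of_mul_le_mul_left ?_ hk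
      rw [pow_succ] at htk
      linarith [congrArg (k * τ * ·) ht₀, congrArg (Θ ^ j * ·) hΘ_def]
    have hsub := hτ _ Ω hΩ t₀ t _ ht₀t ((Icc_subset_Icc_left ht₀_nonneg).trans
      (Icc_subset_Ico_right ht.2)) (ht₀ ▸ hΘj) hstep
      (ih t₀ ⟨ht₀_nonneg, ht₀t.trans_lt ht.2⟩ ht₀.ge)
    rwa [show cylinderRadius f α t₀ = cylinderRadius f α τ ^ j by
      rw [hradius, cylinderRadius, ← hk_def, ht₀]] at hsub

lemma IsSpeedFunction.exists_loss (hf : IsSpeedFunction f) (hα : 0 < α)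
    (hI : CylindricalDegeneracy f α) (hF : 0 < fHat f 0) :
    ∃ D > 0, ∀ (L T : ℝ) (Ω : ℝ → Set (AmbientSpace n)),
      IsOuterBarrier f α (Ico 0 T) Ω → openCylinder n 1 L ⊆ Ω 0 →
      ∀ t ∈ Ico 0 T, t < collapseTime f α →
        openCylinder n (cylinderRadius f α t) (L - D) ⊆ Ω t := by
  obtain ⟨τ, hτ₀, hkτ, hτ⟩ := hf.exists_isPersistenceTime hα hI
  have hk : 0 < (1 + α) * fHat f 0 ^ α := mul_pos (by linarith) (Real.rpow_pos_of_pos hF _)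
  have hΘ : 1 - (1 + α) * fHat f 0 ^ α * τ < 1 := sub_lt_self _ (by positivity)
  have hθ : 0 ≤ cylinderRadius f α τ := Real.rpow_nonneg (by linarith) _
  have hθ_lt : cylinderRadius f α τ < 1 := Real.rpow_lt_one (by linarith) hΘ (by positivity)
  refine ⟨2 * (1 - cylinderRadius f α τ)⁻¹, mul_pos two_pos (inv_pos.mpr (sub_pos.mpr hθ_lt)),
    fun L T Ω hΩ hin t ht htc => ?_⟩
  have hkt : 0 < 1 - (1 + α) * fHat f 0 ^ α * t := by
    rw [collapseTime, lt_div_iff₀ hk] at htc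
    linarith
  obtain ⟨j, hj⟩ := exists_pow_lt_of_lt_one hkt hΘ
  have hgeo : ∑ i ∈ Finset.range j, cylinderRadius f α τ ^ i ≤ (1 - cylinderRadius f α τ)⁻¹ := by
    rw [← tsum_geometric_of_lt_one hθ hθ_lt]
    exact (summable_geometric_of_lt_one hθ hθ_lt).sum_le_tsum _ fun i _ => pow_nonneg hθ i
  exact (openCylinder_mono (cylinderRadius_pos hk htc).le le_rfl (by linarith)).trans
    (hτ.openCylinder_subset_of_pow_le hk hτ₀.le (by linarith) hΩ hin j t ht hj.le)

end Persistence

section Geometry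

lemma exists_add_smul_mem_frontier {E : Type*} [NormedAddCommGroup E] [NormedSpace ℝ E] {S : Set E}
    (hS : Bornology.IsBounded S) {x v : E} (hx : x ∈ S) (hv : v ≠ 0) :
    ∃ s : ℝ, 0 ≤ s ∧ x + s • v ∈ frontier S := by
  have hg : Continuous fun s : ℝ => x + |s| • v := by fun_prop
  have hne : ((fun s : ℝ => x + |s| • v) ⁻¹' S).Nonempty := ⟨0, by simpa using hx⟩
  have hcompl : (fun s : ℝ => x + |s| • v) ⁻¹' S ≠ univ := by
    obtain ⟨M, hM, hle⟩ := hS.exists_pos_norm_le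
    rw [ne_univ_iff_exists_notMem]
    refine ⟨(M + ‖x‖ + 1) / ‖v‖, fun hs => ?_⟩
    have hfar : ‖|(M + ‖x‖ + 1) / ‖v‖| • v‖ = M + ‖x‖ + 1 := by
      rw [norm_smul, Real.norm_eq_abs, abs_abs, abs_of_nonneg (by positivity),
        div_mul_cancel₀ _ (norm_ne_zero_iff.mpr hv)]
    linarith [norm_le_add_norm_add (|(M + ‖x‖ + 1) / ‖v‖| • v) x, hle _ hs,
      congrArg norm (add_comm x (|(M + ‖x‖ + 1) / ‖v‖| • v))]
  obtain ⟨s, hs⟩ := nonempty_frontier_iff.mpr ⟨hne, hcompl⟩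
  exact ⟨|s|, abs_nonneg s, hg.frontier_preimage_subset S hs⟩

variable {n : ℕ}

lemma continuous_last (n : ℕ) : Continuous fun x : AmbientSpace n => x (Fin.last n) := by
  fun_prop

lemma isClosed_closedCylinder (n : ℕ) (r : ℝ) : IsClosed (closedCylinder n r) :=
  isClosed_le (by fun_prop) continuous_const

lemma smul_axisVector_mem_axisSegment {c d y : ℝ} (hy : y ∈ Icc c d) :
    y • axisVector n ∈ axisSegment n c d :=
  ⟨fun i => by simp [axisVector], by simpa [axisVector_last] using hy⟩

lemma eq_smul_axisVector {c d : ℝ} {x : AmbientSpace n} (hx : x ∈ axisSegment n c d) :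
    x = x (Fin.last n) • axisVector n := by
  ext i
  refine Fin.lastCases (by simp [axisVector]) (fun j => ?_) i
  simp [hx.1 j, axisVector]

lemma dist_smul_axisVector_le {x : AmbientSpace n} {r : ℝ} (hx : x ∈ closedCylinder n r) :
    dist x (x (Fin.last n) • axisVector n) ≤ |r| := by
  have hsq : ‖x - x (Fin.last n) • axisVector n‖ ^ 2 = radialSq x := by
    rw [norm_sq_eq_radialSq_add]
    simp [radialSq, axisVector]
  rw [dist_eq_norm, ← abs_norm, ← sq_le_sq, hsq]
  exact hx

lemma axisSegment_subset_openCylinder {r ℓ ℓ' : ℝ} (hr : 0 < r) (hℓ : ℓ < ℓ') :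
    axisSegment n (-ℓ) ℓ ⊆ openCylinder n r ℓ' := fun x hx =>
  ⟨by simpa [hx.1] using pow_pos hr 2, by linarith [hx.2.1], by linarith [hx.2.2]⟩

lemma exists_mem_Icc_abs_sub_le {c d c' d' y δ : ℝ} (hcd' : c' ≤ d') (hc : |c - c'| ≤ δ)
    (hd : |d - d'| ≤ δ) (hy : y ∈ Icc c d) : ∃ z ∈ Icc c' d', |y - z| ≤ δ := by
  have hc := abs_le.mp hc
  have hd := abs_le.mp hd
  rcases lt_or_ge y c' with hyc | hyc
  · exact ⟨c', left_mem_Icc.mpr hcd', abs_le.mpr ⟨by linarith [hy.1], by linarith⟩⟩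
  rcases lt_or_ge d' y with hyd | hyd
  · exact ⟨d', right_mem_Icc.mpr hcd', abs_le.mpr ⟨by linarith, by linarith [hy.2]⟩⟩
  · exact ⟨y, ⟨hyc, hyd⟩, by simpa using (abs_nonneg _).trans (abs_le.mpr hc)⟩

lemma exists_mem_axisSegment_edist_le {c d c' d' δ : ℝ} (hcd' : c' ≤ d') (hc : |c - c'| ≤ δ)
    (hd : |d - d'| ≤ δ) {x : AmbientSpace n} (hx : x ∈ axisSegment n c d) :
    ∃ z ∈ axisSegment n c' d', edist x z ≤ ENNReal.ofReal δ := by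
  obtain ⟨z, hz, hle⟩ := exists_mem_Icc_abs_sub_le hcd' hc hd hx.2
  refine ⟨z • axisVector n, smul_axisVector_mem_axisSegment hz, ?_⟩
  rw [eq_smul_axisVector hx, edist_dist, dist_eq_norm, ← sub_smul, norm_smul, norm_axisVector,
    mul_one]
  exact ENNReal.ofReal_le_ofReal hle

lemma hausdorffEDist_axisSegment_le {c d c' d' δ : ℝ} (hcd : c ≤ d) (hcd' : c' ≤ d')
    (hc : |c - c'| ≤ δ) (hd : |d - d'| ≤ δ) :
    Metric.hausdorffEDist (axisSegment n c d) (axisSegment n c' d') ≤ ENNReal.ofReal δ :=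
  Metric.hausdorffEDist_le_of_mem_edist
    (fun _ hx => exists_mem_axisSegment_edist_le hcd' hc hd hx)
    (fun _ hx => exists_mem_axisSegment_edist_le hcd (abs_sub_comm c c' ▸ hc)
      (abs_sub_comm d d' ▸ hd) hx)

variable {S : Set (AmbientSpace n)}

/-- The support function of `S` in the axial direction with sign `σ = ±1`; hence `S` occupies the
axial range from `-axialSupport (-1) S` to `axialSupport 1 S`. -/
noncomputable def axialSupport (σ : ℝ) (S : Set (AmbientSpace n)) : ℝ :=
  sSup ((fun x => σ * x (Fin.last n)) '' S)

lemma le_axialSupport (hS : Bornology.IsBounded S) (σ : ℝ) {x : AmbientSpace n} (hx : x ∈ S) :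
    σ * x (Fin.last n) ≤ axialSupport σ S := by
  have hcompact := hS.isCompact_closure.image (continuous_const.mul (continuous_last n) :
    Continuous fun x : AmbientSpace n => σ * x (Fin.last n))
  exact le_csSup (hcompact.bddAbove.mono (image_mono subset_closure)) (mem_image_of_mem _ hx)

lemma exists_mem_closure_eq_axialSupport (hS : Bornology.IsBounded S) (hne : S.Nonempty) (σ : ℝ) :
    ∃ x ∈ closure S, σ * x (Fin.last n) = axialSupport σ S := by
  have hcont : Continuous fun x : AmbientSpace n => σ * x (Fin.last n) :=
    continuous_const.mul (continuous_last n)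
  have hbdd := (hS.isCompact_closure.image hcont).bddAbove.mono (image_mono subset_closure)
  have hmem := csSup_mem_closure (hne.image _) hbdd
  rwa [← image_closure_of_isCompact hS.isCompact_closure hcont.continuousOn] at hmem

lemma last_mem_Icc_axialSupport (hS : Bornology.IsBounded S) {x : AmbientSpace n} (hx : x ∈ S) :
    x (Fin.last n) ∈ Icc (-axialSupport (-1) S) (axialSupport 1 S) :=
  ⟨by linarith [le_axialSupport hS (-1) hx], by linarith [le_axialSupport hS 1 hx]⟩

lemma not_frontier_subset_ball (hS : Bornology.IsBounded S) {m : ℝ} (hm : 0 < m)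
    (hseg : axisSegment n (-m) m ⊆ S) (p : AmbientSpace n) : ¬ frontier S ⊆ Metric.ball p m := by
  intro hball
  have hv : axisVector n ≠ 0 := norm_ne_zero_iff.mp (by simp [norm_axisVector])
  have hlast {x : AmbientSpace n} (hx : x ∈ frontier S) :
      |x (Fin.last n) - p (Fin.last n)| < m :=
    (abs_last_le_norm (x - p)).trans_lt (mem_ball_iff_norm.mp (hball hx))
  obtain ⟨s, hs, htop⟩ := exists_add_smul_mem_frontier hS
    (hseg (smul_axisVector_mem_axisSegment ⟨by linarith, le_refl m⟩)) hv
  obtain ⟨s', hs', hbot⟩ := exists_add_smul_mem_frontier hS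
    (hseg (smul_axisVector_mem_axisSegment ⟨le_refl (-m), by linarith⟩)) (neg_ne_zero.mpr hv)
  have htop' := (abs_lt.mp (hlast htop)).2
  have hbot' := (abs_lt.mp (hlast hbot)).1
  simp only [PiLp.add_apply, PiLp.smul_apply, PiLp.neg_apply, axisVector_last, smul_eq_mul]
    at htop' hbot'
  linarith

variable [NeZero n]

lemma interior_closedCylinder_zero (n : ℕ) [NeZero n] : interior (closedCylinder n 0) = ∅ := by
  let W := LinearMap.ker (EuclideanSpace.proj (𝕜 := ℝ) (0 : Fin n).castSucc :
    AmbientSpace n →L[ℝ] ℝ).toLinearMap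
  have hsub : closedCylinder n 0 ⊆ W := fun x hx => by
    have hle : x (0 : Fin n).castSucc ^ 2 ≤ 0 :=
      (Finset.single_le_sum (f := fun i : Fin n => x i.castSucc ^ 2) (fun i _ => sq_nonneg _)
        (Finset.mem_univ 0)).trans (hx.trans_eq (zero_pow two_ne_zero))
    exact pow_eq_zero_iff two_ne_zero |>.mp (le_antisymm hle (sq_nonneg _))
  have hW : W ≠ ⊤ := fun h => by
    have hmem : EuclideanSpace.single (0 : Fin n).castSucc (1 : ℝ) ∈ W := h ▸ Submodule.mem_top
    simp [W] at hmem
  by_contra hne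
  exact hW (W.eq_top_of_nonempty_interior'
    ((nonempty_iff_ne_empty.mpr hne).mono (interior_mono hsub)))

lemma exists_mem_frontier_last_eq (hS : Bornology.IsBounded S) (hconn : IsConnected S) {y : ℝ}
    (hy : y ∈ Icc (-axialSupport (-1) S) (axialSupport 1 S)) :
    ∃ x ∈ frontier S, x (Fin.last n) = y := by
  obtain ⟨p, hp, hpy⟩ := exists_mem_closure_eq_axialSupport hS hconn.nonempty (-1)
  obtain ⟨q, hq, hqy⟩ := exists_mem_closure_eq_axialSupport hS hconn.nonempty 1
  obtain ⟨z, hz, rfl⟩ := hconn.isPreconnected.closure.intermediate_value hp hq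
    (continuous_last n).continuousOn
    (show y ∈ Icc _ _ from ⟨by linarith [hy.1], by linarith [hy.2]⟩)
  have hv : (EuclideanSpace.single (0 : Fin n).castSucc 1 : AmbientSpace n) ≠ 0 := by simp
  obtain ⟨s, -, hs⟩ := exists_add_smul_mem_frontier hS.closure hz hv
  exact ⟨_, frontier_closure_subset hs, by simp [NeZero.ne n]⟩

lemma hausdorffEDist_frontier_axisSegment_le (hS : Bornology.IsBounded S) (hconn : IsConnected S)
    {r : ℝ} (hr : S ⊆ closedCylinder n r) :
    Metric.hausdorffEDist (frontier S)
      (axisSegment n (-axialSupport (-1) S) (axialSupport 1 S)) ≤ ENNReal.ofReal |r| := by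
  have hdist {x : AmbientSpace n} (hx : x ∈ frontier S) :
      edist x (x (Fin.last n) • axisVector n) ≤ ENNReal.ofReal |r| := by
    rw [edist_dist]
    exact ENNReal.ofReal_le_ofReal (dist_smul_axisVector_le
      (closure_minimal hr (isClosed_closedCylinder n r) (frontier_subset_closure hx)))
  refine Metric.hausdorffEDist_le_of_mem_edist (fun x hx => ?_) (fun x hx => ?_)
  · refine ⟨_, smul_axisVector_mem_axisSegment ?_, hdist hx⟩
    exact closure_minimal (fun z hz => last_mem_Icc_axialSupport hS hz)
      (isClosed_Icc.preimage (continuous_last n)) (frontier_subset_closure hx)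
  · obtain ⟨q, hq, hqx⟩ := exists_mem_frontier_last_eq hS hconn hx.2
    refine ⟨q, hq, ?_⟩
    rw [eq_smul_axisVector hx, ← hqx, edist_comm]
    exact hdist hq

lemma tendsto_hausdorffEDist_frontier {ι : Type*} {l : Filter ι} {S : ι → Set (AmbientSpace n)}
    {r : ι → ℝ} {c d : ℝ} (hS : ∀ᶠ t in l, Bornology.IsBounded (S t))
    (hconn : ∀ᶠ t in l, IsConnected (S t)) (hcyl : ∀ᶠ t in l, S t ⊆ closedCylinder n (r t))
    (hr : Tendsto r l (𝓝 0)) (hcd : c ≤ d)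
    (hc : Tendsto (fun t => axialSupport (-1) (S t)) l (𝓝 (-c)))
    (hd : Tendsto (fun t => axialSupport 1 (S t)) l (𝓝 d)) :
    Tendsto (fun t => Metric.hausdorffEDist (frontier (S t)) (axisSegment n c d)) l (𝓝 0) := by
  have hbound : Tendsto (fun t => ENNReal.ofReal |r t| + ENNReal.ofReal
      (max |-axialSupport (-1) (S t) - c| |axialSupport 1 (S t) - d|)) l (𝓝 0) := by
    have hc' := (hc.neg.sub_const c).abs
    have hd' := (hd.sub_const d).abs
    simpa using (ENNReal.tendsto_ofReal hr.abs).add (ENNReal.tendsto_ofReal (hc'.max hd'))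
  refine tendsto_of_tendsto_of_tendsto_of_le_of_le' tendsto_const_nhds hbound
    (Eventually.of_forall fun _ => zero_le) ?_
  filter_upwards [hS, hconn, hcyl] with t hSt hconnt hcylt
  obtain ⟨x, hx⟩ := hconnt.nonempty
  have hle := last_mem_Icc_axialSupport hSt hx
  exact Metric.hausdorffEDist_triangle.trans (add_le_add
    (hausdorffEDist_frontier_axisSegment_le hSt hconnt hcylt)
    (hausdorffEDist_axisSegment_le (hle.1.trans hle.2) hcd (le_max_left _ _) (le_max_right _ _)))

end Geometry

section Collapse

variable {n : ℕ} [NeZero n] {f : (Fin n → ℝ) → ℝ} {α T : ℝ} {Ω : ℝ → Set (AmbientSpace n)}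

lemma collapseTime_pos (hk : 0 < (1 + α) * fHat f 0 ^ α) : 0 < collapseTime f α :=
  one_div_pos.mpr hk

lemma subset_closedCylinder_of_le_collapseTime (hf : IsSpeedFunction f) (hα : 0 < α)
    (hk : 0 < (1 + α) * fHat f 0 ^ α) (hΩ : IsInnerBarrier f α (Ico 0 T) Ω)
    (hb : Bornology.IsBounded (Ω 0)) (hout : Ω 0 ⊆ closedCylinder n 1) {t : ℝ} (ht : t ∈ Ico 0 T)
    (htc : t ≤ collapseTime f α) : Ω t ⊆ closedCylinder n (cylinderRadius f α t) :=
  subset_closedCylinder hf hα hΩ hb hout ht (by rwa [collapseTime, le_div_iff₀' hk] at htc)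

lemma le_collapseTime_of_nonempty_interior (hf : IsSpeedFunction f) (hα : 0 < α)
    (hk : 0 < (1 + α) * fHat f 0 ^ α) (hΩ : IsInnerBarrier f α (Ico 0 T) Ω)
    (hb : Bornology.IsBounded (Ω 0)) (hout : Ω 0 ⊆ closedCylinder n 1)
    (hinteg : ∀ t ∈ Ico 0 T, (interior (Ω t)).Nonempty) : T ≤ collapseTime f α := by
  by_contra! hT
  have htc : collapseTime f α ∈ Ico 0 T := ⟨(collapseTime_pos hk).le, hT⟩
  have hsub := subset_closedCylinder_of_le_collapseTime hf hα hk hΩ hb hout htc le_rfl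
  rw [cylinderRadius_collapseTime hα hk] at hsub
  have hne := (hinteg _ htc).mono (interior_mono hsub)
  rw [interior_closedCylinder_zero] at hne
  exact not_nonempty_empty hne

lemma antitoneOn_axialSupport (hf : IsSpeedFunction f) (hα : 0 < α)
    (hΩ : IsInnerBarrier f α (Ico 0 T) Ω) (hb : Bornology.IsBounded (Ω 0)) {t₁ σ : ℝ}
    (htT : t₁ ≤ T) (hσ : σ ^ 2 = 1) (hne : ∀ t ∈ Ico 0 t₁, (Ω t).Nonempty) :
    AntitoneOn (fun t => axialSupport σ (Ω t)) (Ico 0 t₁) := by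
  intro s hs t ht hst
  have hbs := isBounded_of_isInnerBarrier hf hα hΩ hb ⟨hs.1, hs.2.trans_le htT⟩
  refine csSup_le ((hne t ht).image _) (forall_mem_image.mpr ?_)
  exact axial_le_of_isInnerBarrier hf hα hΩ hs.1 hst (ht.2.trans_le htT) hbs hσ
    fun x hx => le_axialSupport hbs σ hx

lemma exists_tendsto_axialSupport (hf : IsSpeedFunction f) (hα : 0 < α)
    (hΩ : IsInnerBarrier f α (Ico 0 T) Ω) (hb : Bornology.IsBounded (Ω 0)) {t₁ σ m : ℝ}
    (ht₁ : 0 < t₁) (htT : t₁ ≤ T) (hσ : σ ^ 2 = 1) (hne : ∀ t ∈ Ico 0 t₁, (Ω t).Nonempty)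
    (hm : ∀ t ∈ Ico 0 t₁, m ≤ axialSupport σ (Ω t)) :
    ∃ E, m ≤ E ∧ Tendsto (fun t => axialSupport σ (Ω t)) (𝓝[<] t₁) (𝓝 E) := by
  have hlim := ((antitoneOn_axialSupport hf hα hΩ hb htT hσ hne).mono
    Ioo_subset_Ico_self).tendsto_nhdsWithin_Ioo_left (nonempty_Ioo.mpr ht₁)
    ⟨m, forall_mem_image.mpr fun t ht => hm t (Ioo_subset_Ico_self ht)⟩
  refine ⟨_, ge_of_tendsto hlim ?_, hlim⟩
  filter_upwards [Ioo_mem_nhdsLT ht₁] with t ht using hm t (Ioo_subset_Ico_self ht)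

lemma exists_tendsto_hausdorffEDist_frontier (hf : IsSpeedFunction f) (hα : 0 < α)
    (hk : 0 < (1 + α) * fHat f 0 ^ α) (hΩ : IsInnerBarrier f α (Ico 0 T) Ω)
    (hb : Bornology.IsBounded (Ω 0)) (hout : Ω 0 ⊆ closedCylinder n 1)
    (hT : collapseTime f α ≤ T) {m : ℝ} (hm : 0 ≤ m)
    (hseg : ∀ t ∈ Ico 0 (collapseTime f α), axisSegment n (-m) m ⊆ Ω t)
    (hconn : ∀ t ∈ Ico 0 (collapseTime f α), IsPreconnected (Ω t)) :
    ∃ c d : ℝ, c ≤ -m ∧ m ≤ d ∧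
      Tendsto (fun t => Metric.hausdorffEDist (frontier (Ω t)) (axisSegment n c d))
        (𝓝[<] (collapseTime f α)) (𝓝 0) := by
  have htc := collapseTime_pos hk
  have hIco {t : ℝ} (ht : t ∈ Ico 0 (collapseTime f α)) : t ∈ Ico 0 T :=
    ⟨ht.1, ht.2.trans_le hT⟩
  have hmem {t y : ℝ} (ht : t ∈ Ico 0 (collapseTime f α)) (hy : y ∈ Icc (-m) m) :
      y • axisVector n ∈ Ω t := hseg t ht (smul_axisVector_mem_axisSegment hy)
  have hbdd {t : ℝ} (ht : t ∈ Ico 0 (collapseTime f α)) : Bornology.IsBounded (Ω t) :=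
    isBounded_of_isInnerBarrier hf hα hΩ hb (hIco ht)
  have hne (t : ℝ) (ht : t ∈ Ico 0 (collapseTime f α)) : (Ω t).Nonempty :=
    ⟨_, hmem ht (right_mem_Icc.mpr (by linarith))⟩
  obtain ⟨d, hd, hlim_d⟩ := exists_tendsto_axialSupport hf hα hΩ hb (σ := 1) htc hT (by norm_num)
    hne fun t ht => by
      simpa [axisVector_last] using
        le_axialSupport (hbdd ht) 1 (hmem ht (right_mem_Icc.mpr (by linarith)))
  obtain ⟨c, hc, hlim_c⟩ := exists_tendsto_axialSupport hf hα hΩ hb (σ := -1) htc hT (by norm_num)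
    hne fun t ht => by
      simpa [axisVector_last] using
        le_axialSupport (hbdd ht) (-1) (hmem ht (left_mem_Icc.mpr (by linarith)))
  have hradius : Tendsto (cylinderRadius f α) (𝓝[<] (collapseTime f α)) (𝓝 0) := by
    rw [← cylinderRadius_collapseTime hα hk]
    exact (continuous_cylinderRadius hα).continuousWithinAt
  have hev : ∀ᶠ t in 𝓝[<] (collapseTime f α), t ∈ Ico 0 (collapseTime f α) :=
    mem_of_superset (Ioo_mem_nhdsLT htc) Ioo_subset_Ico_self
  refine ⟨-c, d, neg_le_neg hc, hd, tendsto_hausdorffEDist_frontier (hev.mono fun _ => hbdd)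
    (hev.mono fun t ht => ⟨hne t ht, hconn t ht⟩) (hev.mono fun t ht => ?_) hradius (by linarith)
    (by rwa [neg_neg]) hlim_d⟩
  exact subset_closedCylinder_of_le_collapseTime hf hα hk hΩ hb hout (hIco ht) ht.2.le

end Collapse

section SecondFormNorm

variable {n : ℕ}

lemma hasFDerivAt_sum_sq (κ : Fin n → ℝ) :
    HasFDerivAt (fun κ : Fin n → ℝ => ∑ i, κ i ^ 2)
      (∑ i, (2 * κ i) • (ContinuousLinearMap.proj i : (Fin n → ℝ) →L[ℝ] ℝ)) κ :=
  HasFDerivAt.fun_sum fun i _ => by simpa using! (hasFDerivAt_apply (𝕜 := ℝ) i κ).pow 2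

lemma continuous_secondFormNorm (n : ℕ) : Continuous (secondFormNorm n) := by
  unfold secondFormNorm
  fun_prop

variable [NeZero n]

lemma sum_sq_pos {κ : Fin n → ℝ} (hκ : κ ∈ positiveCone n) : 0 < ∑ i, κ i ^ 2 :=
  Finset.sum_pos (fun i _ => pow_pos (hκ i) 2) Finset.univ_nonempty

lemma isSpeedFunction_secondFormNorm : IsSpeedFunction (secondFormNorm n) where
  smooth := ContDiffOn.sqrt (by fun_prop) fun κ hκ => (sum_sq_pos hκ).ne'
  symmetric σ κ _ := congrArg Real.sqrt (Equiv.sum_comp σ fun i => κ i ^ 2)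
  increasing κ hκ i := by
    have hderiv : HasFDerivAt (secondFormNorm n) _ κ :=
      (hasFDerivAt_sum_sq κ).sqrt (sum_sq_pos hκ).ne'
    have happly : (∑ j, (2 * κ j) • (ContinuousLinearMap.proj j : (Fin n → ℝ) →L[ℝ] ℝ))
        (Pi.single i 1) = 2 * κ i := by
      simp [Pi.single_apply]
    rw [hderiv.fderiv, smul_apply, happly, smul_eq_mul]
    have : 0 < ∑ j, κ j ^ 2 := sum_sq_pos hκ
    have : 0 < κ i := hκ i
    positivity
  homogeneous c hc κ _ := by
    simp only [secondFormNorm, Pi.smul_apply, smul_eq_mul, mul_pow]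
    rw [← Finset.mul_sum, Real.sqrt_mul (sq_nonneg c), Real.sqrt_sq hc.le]
  pos κ hκ := Real.sqrt_pos.mpr (sum_sq_pos hκ)

lemma fHat_secondFormNorm {x : ℝ} (hx : 0 ≤ x) :
    fHat (secondFormNorm n) x = √(((n - 1 : ℕ) : ℝ) + x ^ 2) := by
  rw [fHat_eq_of_continuousAt hx (continuous_secondFormNorm n).continuousAt, secondFormNorm]
  have hsq (i : Fin n) : Function.update (fun _ => (1 : ℝ)) 0 x i ^ 2 =
      Function.update (fun _ => (1 : ℝ)) 0 (x ^ 2) i := by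
    rcases eq_or_ne i 0 with rfl | hi <;> simp [*]
  simp only [hsq]
  rw [Finset.sum_update_of_mem (Finset.mem_univ _)]
  simp [Finset.card_sdiff, add_comm]

lemma fHat_secondFormNorm_zero_pos (hn : 2 ≤ n) : 0 < fHat (secondFormNorm n) 0 := by
  have : (0 : ℝ) < ((n - 1 : ℕ) : ℝ) := by exact_mod_cast (by lia : 0 < n - 1)
  rw [fHat_secondFormNorm le_rfl]
  positivity

lemma exists_gFun_secondFormNorm_le (hn : 2 ≤ n) (α : ℝ) :
    ∃ K : ℝ, 0 < K ∧ ∀ x ∈ Icc (0 : ℝ) 1, gFun (secondFormNorm n) α x ≤ K * x ^ 2 := by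
  obtain ⟨Λ, hΛ, hpow⟩ := exists_rpow_le_one_add (a := 1) (b := 2) one_pos (by norm_num) (α / 2)
  have hb : (1 : ℝ) ≤ ((n - 1 : ℕ) : ℝ) := by exact_mod_cast (by lia : 1 ≤ n - 1)
  set b : ℝ := ((n - 1 : ℕ) : ℝ)
  refine ⟨b ^ (α / 2) * (Λ + 1), by positivity, fun x hx => ?_⟩
  have hfHat {y : ℝ} (hy : 0 ≤ y) :
      fHat (secondFormNorm n) y ^ α = b ^ (α / 2) * (1 + y ^ 2 / b) ^ (α / 2) := by
    rw [fHat_secondFormNorm hy, Real.sqrt_eq_rpow, ← Real.rpow_mul (by positivity),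
      one_div_mul_eq_div, ← Real.mul_rpow (by positivity) (by positivity), mul_add, mul_one,
      mul_div_cancel₀ _ (by positivity)]
  have hx2 : x ^ 2 ≤ 1 := pow_le_one₀ hx.1 hx.2
  have hdiv : x ^ 2 / b ≤ x ^ 2 := div_le_self (sq_nonneg x) hb
  have hdiv₀ : 0 ≤ x ^ 2 / b := by positivity
  have hle : (1 + x ^ 2 / b) ^ (α / 2) - 1 ≤ (Λ + 1) * x ^ 2 := by
    have := hpow (1 + x ^ 2 / b) ⟨by linarith, by linarith⟩
    rw [add_sub_cancel_left, abs_of_nonneg hdiv₀] at this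
    linarith [mul_le_mul_of_nonneg_left hdiv hΛ, sq_nonneg x]
  calc gFun (secondFormNorm n) α x = b ^ (α / 2) * ((1 + x ^ 2 / b) ^ (α / 2) - 1) := by
        rw [gFun, hfHat hx.1, hfHat le_rfl]
        simp [mul_sub]
    _ ≤ b ^ (α / 2) * ((Λ + 1) * x ^ 2) := mul_le_mul_of_nonneg_left hle (by positivity)
    _ = b ^ (α / 2) * (Λ + 1) * x ^ 2 := (mul_assoc _ _ _).symm

end SecondFormNorm

section QuadraticDegeneracy

variable {n : ℕ} [NeZero n] {f : (Fin n → ℝ) → ℝ} {α K : ℝ}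

lemma inv_gInv_le_of_gFun_le_sq (hK : 0 < K)
    (hle : ∀ x ∈ Icc (0 : ℝ) 1, gFun f α x ≤ K * x ^ 2) {z : ℝ} (hz : 0 < z) :
    (gInv f α z)⁻¹ ≤ ENNReal.ofReal (1 + √K * z ^ (-(1 / 2) : ℝ)) := by
  have hsqrt : 0 < √(z / K) := Real.sqrt_pos.mpr (div_pos hz hK)
  have hmin : 0 < min 1 √(z / K) := lt_min one_pos hsqrt
  have hlower : ENNReal.ofReal (min 1 √(z / K)) ≤ gInv f α z := by
    refine le_iInf₂ fun x hx => ENNReal.ofReal_le_ofReal ?_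
    rcases le_total x 1 with hx₁ | hx₁
    · refine (min_le_right _ _).trans ?_
      rw [Real.sqrt_le_left hx.1, div_le_iff₀' hK]
      exact hx.2.trans (hle x ⟨hx.1, hx₁⟩)
    · exact (min_le_left _ _).trans hx₁
  have hpow : √K * z ^ (-(1 / 2) : ℝ) = (√(z / K))⁻¹ := by
    rw [Real.rpow_neg hz.le, ← Real.sqrt_eq_rpow, Real.sqrt_div hz.le, inv_div, div_eq_mul_inv]
  refine (ENNReal.inv_le_inv.mpr hlower).trans ?_
  rw [← ENNReal.ofReal_inv_of_pos hmin, hpow]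
  refine ENNReal.ofReal_le_ofReal ?_
  rcases min_choice 1 √(z / K) with h | h <;> rw [h]
  · linarith [inv_pos.mpr hsqrt, inv_one (G := ℝ)]
  · linarith

lemma cylindricalDegeneracy_of_gFun_le_sq (hK : 0 < K)
    (hle : ∀ x ∈ Icc (0 : ℝ) 1, gFun f α x ≤ K * x ^ 2) : CylindricalDegeneracy f α := by
  have hinteg : IntegrableOn (fun z : ℝ => 1 + √K * z ^ (-(1 / 2) : ℝ)) (Ioo 0 1) :=
    (integrable_const _).add
      (((intervalIntegral.integrableOn_Ioo_rpow_iff one_pos).mpr (by norm_num)).const_mul _)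
  exact (setLIntegral_mono' measurableSet_Ioo fun z hz =>
    inv_gInv_le_of_gFun_le_sq hK hle hz.1).trans_lt hinteg.lintegral_lt_top

end QuadraticDegeneracy

theorem theorem19_general {n : ℕ} [NeZero n] {f : (Fin n → ℝ) → ℝ} {α : ℝ} (hα : 0 < α)
    (hf : IsSpeedFunction f) (hI : CylindricalDegeneracy f α) :
    (∃ τ : ℝ, 0 < τ ∧ (1 + α) * fHat f 0 ^ α * τ < 1 ∧
      ∀ (L T : ℝ) (Ω : ℝ → Set (AmbientSpace n)),
        IsBarrierSolution f α (Set.Ico 0 T) Ω → Bornology.IsBounded (Ω 0) →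
        openCylinder n 1 L ⊆ Ω 0 → Ω 0 ⊆ closedCylinder n 1 →
        ∀ t ∈ Set.Icc 0 τ ∩ Set.Ico 0 T,
          openCylinder n (cylinderRadius f α t) (L - 2) ⊆ Ω t ∧
          Ω t ⊆ closedCylinder n (cylinderRadius f α t)) ∧
    (0 < fHat f 0 →
      ∃ C : ℝ, 0 < C ∧
      ∀ (L T : ℝ) (Ω : ℝ → Set (AmbientSpace n)), C < L → 0 < T →
        IsBarrierSolution f α (Set.Ico 0 T) Ω → Bornology.IsBounded (Ω 0) →
        openCylinder n 1 L ⊆ Ω 0 → Ω 0 ⊆ closedCylinder n 1 →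
        (∀ t ∈ Set.Ico 0 T, t < collapseTime f α →
          axisSegment n (-(L - C)) (L - C) ⊆ Ω t ∧
          Ω t ⊆ closedCylinder n (cylinderRadius f α t)) ∧
        ((∀ t ∈ Set.Ico 0 T, (interior (Ω t)).Nonempty) → T ≤ collapseTime f α) ∧
        (T ≤ collapseTime f α → ∀ p : AmbientSpace n,
          ¬ ∀ ε : ℝ, 0 < ε → ∀ᶠ t in 𝓝[<] T, frontier (Ω t) ⊆ Metric.ball p ε) ∧
        (collapseTime f α ≤ T → (∀ t ∈ Set.Ico 0 (collapseTime f α), IsPreconnected (Ω t)) →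
          ∃ c d : ℝ, c ≤ -(L - C) ∧ L - C ≤ d ∧
            Tendsto (fun t => Metric.hausdorffEDist (frontier (Ω t)) (axisSegment n c d))
              (𝓝[<] (collapseTime f α)) (𝓝 0))) := by
  refine ⟨?_, fun hF => ?_⟩
  · obtain ⟨τ, hτ₀, hkτ, hτ⟩ := hf.exists_isPersistenceTime hα hI
    have hk : 0 ≤ (1 + α) * fHat f 0 ^ α :=
      mul_nonneg (by positivity) (Real.rpow_nonneg hf.fHat_zero_nonneg _)
    refine ⟨τ, hτ₀, by linarith, fun L T Ω hΩ hb hin hout t ht =>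
      ⟨hτ.openCylinder_subset_of_le hΩ.1 hin ht.2 ht.1.2,
        subset_closedCylinder hf hα hΩ.2 hb hout ht.2 ?_⟩⟩
    linarith [mul_le_mul_of_nonneg_left ht.1.2 hk]
  obtain ⟨D, hD, hloss⟩ := hf.exists_loss hα hI hF
  have hk : 0 < (1 + α) * fHat f 0 ^ α := mul_pos (by linarith) (Real.rpow_pos_of_pos hF _)
  refine ⟨D + 1, by linarith, fun L T Ω hL hT hΩ hb hin hout => ?_⟩
  have hm : 0 < L - (D + 1) := by linarith
  have hseg (t : ℝ) (ht : t ∈ Ico 0 T) (htc : t < collapseTime f α) :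
      axisSegment n (-(L - (D + 1))) (L - (D + 1)) ⊆ Ω t :=
    (axisSegment_subset_openCylinder (cylinderRadius_pos hk htc) (by linarith)).trans
      (hloss L T Ω hΩ.1 hin t ht htc)
  refine ⟨fun t ht htc => ⟨hseg t ht htc,
      subset_closedCylinder_of_le_collapseTime hf hα hk hΩ.2 hb hout ht htc.le⟩,
    le_collapseTime_of_nonempty_interior hf hα hk hΩ.2 hb hout, fun hTc p hp => ?_,
    fun hTc => exists_tendsto_hausdorffEDist_frontier hf hα hk hΩ.2 hb hout hTc hm.le
      fun t ht => hseg t ⟨ht.1, ht.2.trans_le hTc⟩ ht.2⟩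
  obtain ⟨t, hball, ht⟩ := ((hp _ hm).and (Ioo_mem_nhdsLT hT)).exists
  have htT : t ∈ Ico 0 T := Ioo_subset_Ico_self ht
  exact not_frontier_subset_ball (isBounded_of_isInnerBarrier hf hα hΩ.2 hb htT) hm
    (hseg t htT (ht.2.trans_le hTc)) p hball

theorem theorem19 (n : ℕ) [NeZero n] (α : ℝ) (hα : 0 < α) :
    (∀ f : (Fin n → ℝ) → ℝ, IsSpeedFunction f → CylindricalDegeneracy f α →
      -- a slightly shorter cylindrical piece persists for a short time
      (∃ τ : ℝ, 0 < τ ∧ (1 + α) * fHat f 0 ^ α * τ < 1 ∧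
        ∀ (L T : ℝ) (Ω : ℝ → Set (AmbientSpace n)), 2 < L → 0 < T →
          IsBarrierSolution f α (Set.Ico 0 T) Ω →
          Bornology.IsBounded (Ω 0) →
          openCylinder n 1 L ⊆ Ω 0 → Ω 0 ⊆ closedCylinder n 1 →
          ∀ t ∈ Set.Icc 0 τ ∩ Set.Ico 0 T,
            openCylinder n (cylinderRadius f α t) (L - 2) ⊆ Ω t ∧
            Ω t ⊆ closedCylinder n (cylinderRadius f α t)) ∧
      -- if the cylinder shrinks, long hypersurfaces collapse onto a segment, not to a point
      (0 < fHat f 0 →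
        ∃ C : ℝ, 0 < C ∧
        ∀ (L T : ℝ) (Ω : ℝ → Set (AmbientSpace n)), C < L → 0 < T →
          IsBarrierSolution f α (Set.Ico 0 T) Ω →
          Bornology.IsBounded (Ω 0) →
          openCylinder n 1 L ⊆ Ω 0 → Ω 0 ⊆ closedCylinder n 1 →
          (∀ t ∈ Set.Ico 0 T, t < collapseTime f α →
            axisSegment n (-(L - C)) (L - C) ⊆ Ω t ∧
            Ω t ⊆ closedCylinder n (cylinderRadius f α t)) ∧
          ((∀ t ∈ Set.Ico 0 T, (interior (Ω t)).Nonempty) → T ≤ collapseTime f α) ∧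
          (T ≤ collapseTime f α → ∀ p : AmbientSpace n,
            ¬ ∀ ε : ℝ, 0 < ε → ∀ᶠ t in 𝓝[<] T, frontier (Ω t) ⊆ Metric.ball p ε) ∧
          (collapseTime f α ≤ T → (∀ t ∈ Set.Ico 0 (collapseTime f α), Convex ℝ (Ω t)) →
            ∃ c d : ℝ, c ≤ -(L - C) ∧ L - C ≤ d ∧
              Tendsto (fun t => Metric.hausdorffEDist (frontier (Ω t)) (axisSegment n c d))
                (𝓝[<] (collapseTime f α)) (𝓝 0)))) ∧
    -- the flow with speed `|A|^α` is an example
    (2 ≤ n → IsSpeedFunction (secondFormNorm n) ∧ CylindricalDegeneracy (secondFormNorm n) α ∧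
      0 < fHat (secondFormNorm n) 0) := by
  refine ⟨fun f hf hI => ?_, fun hn => ?_⟩
  · obtain ⟨⟨τ, hτ₀, hkτ, hτ⟩, hcollapse⟩ := theorem19_general hα hf hI
    refine ⟨⟨τ, hτ₀, hkτ, fun L T Ω _ _ => hτ L T Ω⟩, fun hF => ?_⟩
    obtain ⟨C, hC, h⟩ := hcollapse hF
    refine ⟨C, hC, fun L T Ω hL hT hΩ hb hin hout => ?_⟩
    obtain ⟨hsub, hinteg, hpoint, hlim⟩ := h L T Ω hL hT hΩ hb hin hout
    exact ⟨hsub, hinteg, hpoint, fun hTc hconv => hlim hTc fun t ht => (hconv t ht).isPreconnected⟩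
  · obtain ⟨K, hK, hle⟩ := exists_gFun_secondFormNorm_le hn α
    exact ⟨isSpeedFunction_secondFormNorm, cylindricalDegeneracy_of_gFun_le_sq hK hle,
      fHat_secondFormNorm_zero_pos hn⟩
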